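/- **Setting.** Let $n\ge 1$, let $\mu$ be a locally finite Borel measure on $\mathbb R^n$, let $T:L^2(\mu)\to L^2(\mu)$ be a bounded linear operator (for example a bounded Calderón–Zygmund operator), where $L^2(\mu)$ consists of complex-valued functions, and let $A,B\ge 0$ be constants. Let $Q^*\subset\mathbb R^n$ be a half-open cube (sides parallel to the axes), and let $\mathcal D$ be the dyadic grid of half-open cubes obtained by repeatedly bisecting $Q^*$; $\mathrm{ch}(Q)$ denotes the $2^n$ dyadic children of $Q\in\mathcal D$. Write $\langle f\rangle_Q=\mu(Q)^{-1}\int_Q f\,d\mu$. Suppose that for every $Q\in\mathcal D$ there is a function $b_Q\in L^2(\mu)$ with $b_Q=0$ $\mu$-a.e. outside $Q$ and $$\int_Q b_Q\,d\mu=\mu(Q),\qquad \|b_Q\|_{L^2(\mu)}^2\le A\,\mu(Q),\qquad \|1_Q\,Tb_Q\|_{L^2(\mu)}^2\le B\,\mu(Q).$$ Let $M_\mu h(x)=\sup_{r>0}\mu(B(x,r))^{-1}\int_{B(x,r)}|h|\,d\mu$ be the centred maximal function (with $0/0=0$) and $\|M_\mu\|$ the least constant $c$ with $\|M_\mu h\|_{L^2(\mu)}\le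 c\|h\|_{L^2(\mu)}$ for all $h\in L^2(\mu)$. **Stopping cubes.** For $S\in\mathcal D$ the stopping children of $S$ are the maximal cubes $Q\in\mathcal D$, $Q\subset S$, with $\mu(Q)>0$ that satisfy at least one of 1. $|\langle b_S\rangle_Q|<1/2$; 2. $\langle |M_\mu b_S|^2\rangle_Q>16A^2\|M_\mu\|^2$; 3. $\langle |Tb_S|^2\rangle_Q>16AB$. Put $\mathcal F^0=\{Q^*\}$, let $\mathcal F^{j+1}$ be the collection of all stopping children of the cubes in $\mathcal F^j$, and let $\mathcal F=\bigcup_{j\ge 0}\mathcal F^j$. For $Q\in\mathcal D$ let $Q^a\in\mathcal F$ be the minimal cube $S\in\mathcal F$ with $Q\subset S$. **Twisted martingale differences.** For $Q\in\mathcal D$ and $h\in L^2(\mu)$ let $$\Delta_Q h=\sum_{Q'\in\mathrm{ch}(Q)}\left[\frac{\langle h\rangle_{Q'}}{\langle b_{(Q')^a}\rangle_{Q'}}\,b_{(Q')^a}-\frac{\langle h\rangle_Q}{\langle b_{Q^a}\rangle_Q}\,b_{Q^a}\right]1_{Q'},$$ where terms with $\mu(Q')=0$ are understood to be zero. **Proposition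 2.4.** There is a constant $C$, depending only on $n$ and $A$, such that in this setting, for every $F\in\mathcal F$, every $h\in L^2(\mu)$ and all complex constants $\epsilon_Q$, $Q\in\mathcal D$, with $|\epsilon_Q|\le 1$, the series $\sum_{Q\in\mathcal D:\,Q^a=F}\epsilon_Q\Delta_Q h$ converges unconditionally in $L^2(\mu)$ and $$\Big\|\sum_{\substack{Q\in\mathcal D\\ Q^a=F}}\epsilon_Q\,\Delta_Q h\Big\|_{L^2(\mu)}^2\le C\,\|h\|_{L^2(\mu)}^2 .$$ -/

import Mathlib

open MeasureTheory Set
open scoped NNReal ENNReal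

noncomputable section

namespace TwistedMartingale

/-- A half-open cube `∏ᵢ [cornerᵢ, cornerᵢ + side)` in `ℝⁿ`. -/
@[ext]
structure Cube (n : ℕ) where
  corner : Fin n → ℝ
  side : ℝ
  side_pos : 0 < side

namespace Cube

variable {n : ℕ}

/-- The points of the cube. -/
def toSet (Q : Cube n) : Set (EuclideanSpace ℝ (Fin n)) :=
  {x | ∀ i, Q.corner i ≤ x i ∧ x i < Q.corner i + Q.side}

/-- The `2ⁿ` dyadic children of a cube, indexed by the vertices `s ∈ {0,1}ⁿ`. -/
def child (Q : Cube n) (s : Fin n → Fin 2) : Cube n where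
  corner i := Q.corner i + (s i : ℝ) * (Q.side / 2)
  side := Q.side / 2
  side_pos := half_pos Q.side_pos

/-- `Dyadic Qs Q`: the cube `Q` belongs to the dyadic grid with top cube `Qs`, that is, it is
obtained from `Qs` by passing finitely many times to a child. -/
inductive Dyadic (Qs : Cube n) : Cube n → Prop
  | top : Dyadic Qs Qs
  | child {Q : Cube n} (hQ : Dyadic Qs Q) (s : Fin n → Fin 2) : Dyadic Qs (Q.child s)

theorem measurableSet_toSet (Q : Cube n) : MeasurableSet Q.toSet := by
  have h : Q.toSet = ⋂ i, {x : EuclideanSpace ℝ (Fin n) |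
      Q.corner i ≤ x i ∧ x i < Q.corner i + Q.side} := by
    ext x; simp [toSet]
  rw [h]
  refine MeasurableSet.iInter fun i => ?_
  have hm : Measurable fun x : EuclideanSpace ℝ (Fin n) => x i := by fun_prop
  exact (measurableSet_le measurable_const hm).inter (measurableSet_lt hm measurable_const)

end Cube

section MaximalFunction

variable {n : ℕ} (μ : Measure (EuclideanSpace ℝ (Fin n)))

/-- The centred maximal function `M_μ h(x) = sup_{r > 0} μ(B(x,r))⁻¹ ∫_{B(x,r)} |h| dμ`
(balls of measure zero contribute `0 / 0 = 0`). -/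
def maximalFunction (h : EuclideanSpace ℝ (Fin n) → ℂ) (x : EuclideanSpace ℝ (Fin n)) : ℝ≥0∞ :=
  ⨆ (r : ℝ) (_ : 0 < r), (∫⁻ y in Metric.ball x r, ‖h y‖ₑ ∂μ) / μ (Metric.ball x r)

/-- The norm `‖M_μ‖` of the centred maximal function on `L²(μ)`: the least constant `c` with
`‖M_μ h‖_{L²(μ)} ≤ c ‖h‖_{L²(μ)}` for all `h ∈ L²(μ)`. -/
def maximalNorm : ℝ≥0∞ :=
  sInf {c : ℝ≥0∞ | ∀ h : Lp ℂ 2 μ,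
    ∫⁻ x, maximalFunction μ h x ^ 2 ∂μ ≤ c ^ 2 * ∫⁻ x, ‖h x‖ₑ ^ 2 ∂μ}

end MaximalFunction

section Stopping

variable {n : ℕ} {μ : Measure (EuclideanSpace ℝ (Fin n))}

/-- The family `b_Q`, `Q` in the dyadic grid of `Qs`, is a family of `L²` test functions for `T`
with constants `A` and `B`: `b_Q` lives on `Q`, `⟨b_Q⟩_Q = 1`, `‖b_Q‖² ≤ A μ(Q)` and
`‖1_Q T b_Q‖² ≤ B μ(Q)`. The normalisation is written `∫_Q b_Q dμ = μ(Q)`, which is void on cubes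
of measure zero. -/
structure IsTestFamily (T : Lp ℂ 2 μ →L[ℂ] Lp ℂ 2 μ) (A B : ℝ≥0) (Qs : Cube n)
    (b : Cube n → Lp ℂ 2 μ) : Prop where
  support : ∀ Q, Qs.Dyadic Q → ∀ᵐ x ∂μ, x ∉ Q.toSet → b Q x = 0
  normalised : ∀ Q, Qs.Dyadic Q → ∫ x in Q.toSet, b Q x ∂μ = (μ.real Q.toSet : ℂ)
  norm_sq_le : ∀ Q, Qs.Dyadic Q → ‖b Q‖ ^ 2 ≤ A * μ.real Q.toSet
  testing : ∀ Q, Qs.Dyadic Q → ∫ x in Q.toSet, ‖T (b Q) x‖ ^ 2 ∂μ ≤ B * μ.real Q.toSet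

variable (T : Lp ℂ 2 μ →L[ℂ] Lp ℂ 2 μ) (A B : ℝ≥0) (Qs : Cube n) (b : Cube n → Lp ℂ 2 μ)

/-- `Q` satisfies at least one of the three stopping conditions with respect to `b_S`:
`|⟨b_S⟩_Q| < 1/2`, or `⟨|M_μ b_S|²⟩_Q > 16 A² ‖M_μ‖²`, or `⟨|T b_S|²⟩_Q > 16 A B`.
The three averages over `Q` are multiplied by `μ(Q)`, so that a cube of measure zero never
satisfies any of the conditions. -/
def StopCondition (S Q : Cube n) : Prop :=
  ‖∫ x in Q.toSet, b S x ∂μ‖ < 1 / 2 * μ.real Q.toSet ∨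
  16 * (A : ℝ≥0∞) ^ 2 * maximalNorm μ ^ 2 * μ Q.toSet
    < ∫⁻ x in Q.toSet, maximalFunction μ (b S) x ^ 2 ∂μ ∨
  16 * (A : ℝ) * B * μ.real Q.toSet < ∫ x in Q.toSet, ‖T (b S) x‖ ^ 2 ∂μ

/-- The maximal cubes `Q ⊆ S` of the dyadic grid that satisfy a stopping condition with respect
to `b_S`. -/
def stoppingChildren (S : Cube n) : Set (Cube n) :=
  {Q | Qs.Dyadic Q ∧ Q.toSet ⊆ S.toSet ∧ StopCondition T A B b S Q ∧
    ∀ R, Qs.Dyadic R → R.toSet ⊆ S.toSet → StopCondition T A B b S R →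
      Q.toSet ⊆ R.toSet → R = Q}

/-- The stopping cubes of generation `j`. -/
def stoppingGeneration : ℕ → Set (Cube n)
  | 0 => {Qs}
  | j + 1 => {Q | ∃ S ∈ stoppingGeneration j, Q ∈ stoppingChildren T A B Qs b S}

/-- All stopping cubes. -/
def stoppingCubes : Set (Cube n) :=
  ⋃ j, stoppingGeneration T A B Qs b j

/-- `S` is the minimal stopping cube that contains `Q`. -/
def IsMinimalStopping (Q S : Cube n) : Prop :=
  S ∈ stoppingCubes T A B Qs b ∧ Q.toSet ⊆ S.toSet ∧
    ∀ R ∈ stoppingCubes T A B Qs b, Q.toSet ⊆ R.toSet → S.toSet ⊆ R.toSet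

open Classical in
/-- The cube `Qᵃ`, the minimal stopping cube that contains `Q`. If `n ≥ 1` it exists and is unique
for every `Q` in the dyadic grid of `Qs` (see `stoppingAncestor_eq_iff`); elsewhere it is `Q`. -/
def stoppingAncestor (Q : Cube n) : Cube n :=
  if h : ∃ S, IsMinimalStopping T A B Qs b Q S then h.choose else Q

/-- Multiplication of an element of `L²(μ)` by the indicator function of a cube. -/
def indicatorLp (Q : Cube n) (f : Lp ℂ 2 μ) : Lp ℂ 2 μ :=
  ((Lp.memLp f).indicator Q.measurableSet_toSet).toLp (Q.toSet.indicator f)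

/-- The twisted martingale difference
`Δ_Q h = ∑_{Q' ∈ ch(Q)} [⟨h⟩_{Q'} / ⟨b_{Q'ᵃ}⟩_{Q'} b_{Q'ᵃ} - ⟨h⟩_Q / ⟨b_{Qᵃ}⟩_Q b_{Qᵃ}] 1_{Q'}`.
Averages over cubes of measure zero are `0`; the corresponding terms vanish `μ`-a.e. anyway. -/
def twistedDifference (Q : Cube n) (h : Lp ℂ 2 μ) : Lp ℂ 2 μ :=
  ∑ s : Fin n → Fin 2, indicatorLp (Q.child s)
    (((⨍ x in (Q.child s).toSet, h x ∂μ) /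
          (⨍ x in (Q.child s).toSet, b (stoppingAncestor T A B Qs b (Q.child s)) x ∂μ)) •
        b (stoppingAncestor T A B Qs b (Q.child s)) -
      ((⨍ x in Q.toSet, h x ∂μ) /
          (⨍ x in Q.toSet, b (stoppingAncestor T A B Qs b Q) x ∂μ)) •
        b (stoppingAncestor T A B Qs b Q))

end Stopping

section AncestorSpec

variable {n : ℕ}

theorem Cube.Dyadic.exists_index {Qs Q : Cube n} (h : Qs.Dyadic Q) :
    ∃ (k : ℕ) (j : Fin n → ℕ), Qs.side = 2 ^ k * Q.side ∧
      ∀ i, Q.corner i = Qs.corner i + j i * Q.side := by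
  induction h with
  | top => exact ⟨0, 0, by simp, by simp⟩
  | @child Q hQ s ih =>
    obtain ⟨k, j, h1, h2⟩ := ih
    refine ⟨k + 1, fun i => 2 * j i + (s i : ℕ), ?_, fun i => ?_⟩
    · rw [h1]; simp only [Cube.child]; ring
    · simp only [Cube.child, h2 i]; push_cast; ring

theorem Cube.Dyadic.subset_of_le {Qs Q R : Cube n} (hQ : Qs.Dyadic Q) (hR : Qs.Dyadic R)
    {x : EuclideanSpace ℝ (Fin n)} (hxQ : x ∈ Q.toSet) (hxR : x ∈ R.toSet)
    (hle : Q.side ≤ R.side) : Q.toSet ⊆ R.toSet := by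
  obtain ⟨k, j, h1, h2⟩ := hQ.exists_index
  obtain ⟨l, m, h3, h4⟩ := hR.exists_index
  have hq := Q.side_pos
  have hlk : l ≤ k := by
    by_contra! hc
    have h5 : (2 : ℝ) ^ k < 2 ^ l := pow_lt_pow_right₀ (by norm_num) hc
    have := mul_lt_mul h5 hle hq (by positivity)
    linarith
  obtain ⟨d, rfl⟩ := Nat.exists_eq_add_of_le hlk
  have hs : R.side = ((2 ^ d : ℕ) : ℝ) * Q.side := by
    have : (2 : ℝ) ^ l * R.side = 2 ^ l * (2 ^ d * Q.side) := by
      rw [← h3, h1, pow_add]; ring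
    push_cast
    exact mul_left_cancel₀ (by positivity) this
  intro y hy i
  have ha := hxQ i
  have hb := hxR i
  have hc := hy i
  rw [h2 i] at ha hc
  rw [h4 i, hs] at hb ⊢
  have e1 : m i * 2 ^ d < j i + 1 := by
    have : ((m i * 2 ^ d : ℕ) : ℝ) * Q.side < ((j i + 1 : ℕ) : ℝ) * Q.side := by
      push_cast at hb ⊢; linarith
    exact_mod_cast lt_of_mul_lt_mul_right this hq.le
  have e2 : j i < (m i + 1) * 2 ^ d := by
    have : ((j i : ℕ) : ℝ) * Q.side < (((m i + 1) * 2 ^ d : ℕ) : ℝ) * Q.side := by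
      push_cast at hb ⊢; linarith
    exact_mod_cast lt_of_mul_lt_mul_right this hq.le
  have f1 : ((m i * 2 ^ d : ℕ) : ℝ) * Q.side ≤ (j i : ℝ) * Q.side :=
    mul_le_mul_of_nonneg_right (by exact_mod_cast Nat.lt_succ_iff.mp e1) hq.le
  have f2 : ((j i + 1 : ℕ) : ℝ) * Q.side ≤ (((m i + 1) * 2 ^ d : ℕ) : ℝ) * Q.side :=
    mul_le_mul_of_nonneg_right (by exact_mod_cast e2) hq.le
  push_cast at f1 f2 ⊢
  constructor <;> linarith

theorem Cube.corner_mem (Q : Cube n) : WithLp.toLp 2 Q.corner ∈ Q.toSet := by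
  intro i
  simp [Q.side_pos]

theorem Cube.side_le_of_subset (hn : 0 < n) {Q R : Cube n} (h : Q.toSet ⊆ R.toSet) :
    Q.side ≤ R.side := by
  by_contra! hlt
  have hr := R.side_pos
  have h1 := h Q.corner_mem ⟨0, hn⟩
  have hy : WithLp.toLp 2 (fun i => Q.corner i + R.side) ∈ Q.toSet := by
    intro i
    simp [hlt, hr.le]
  have h2 := h hy ⟨0, hn⟩
  simp only at h1 h2
  linarith [h1.1, h2.2]

theorem Cube.toSet_injective (hn : 0 < n) {Q R : Cube n} (h : Q.toSet = R.toSet) : Q = R := by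
  have hs : Q.side = R.side :=
    le_antisymm (Cube.side_le_of_subset hn h.le) (Cube.side_le_of_subset hn h.ge)
  ext i
  · have h1 := h.le Q.corner_mem i
    have h2 := h.ge R.corner_mem i
    exact le_antisymm h2.1 h1.1
  · exact hs

variable {μ : Measure (EuclideanSpace ℝ (Fin n))}
  (T : Lp ℂ 2 μ →L[ℂ] Lp ℂ 2 μ) (A B : ℝ≥0) (Qs : Cube n) (b : Cube n → Lp ℂ 2 μ)

theorem dyadic_of_mem_stoppingCubes {S : Cube n} (hS : S ∈ stoppingCubes T A B Qs b) :
    Qs.Dyadic S := by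
  obtain ⟨j, hj⟩ := mem_iUnion.mp hS
  cases j with
  | zero =>
    rw [stoppingGeneration, mem_singleton_iff] at hj
    exact hj ▸ Cube.Dyadic.top
  | succ j =>
    obtain ⟨R, _, hR⟩ := hj
    exact hR.1

theorem Cube.Dyadic.subset_top {Qs Q : Cube n} (h : Qs.Dyadic Q) : Q.toSet ⊆ Qs.toSet := by
  induction h with
  | top => exact subset_rfl
  | @child Q hQ s ih =>
    refine Subset.trans (b := Q.toSet) ?_ ih
    intro x hx i
    have h1 := hx i
    have hq := Q.side_pos
    simp only [Cube.child] at h1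
    have h2 : ((s i : ℕ) : ℝ) ≤ 1 := by
      have : (s i : ℕ) ≤ 1 := by omega
      exact_mod_cast this
    have h3 : (0 : ℝ) ≤ ((s i : ℕ) : ℝ) := by positivity
    constructor
    · nlinarith [h1.1]
    · nlinarith [h1.2]

/-- Every cube of the grid has exactly one minimal stopping cube above it. -/
theorem existsUnique_isMinimalStopping (hn : 0 < n) {Q : Cube n} (hQ : Qs.Dyadic Q) :
    ∃! S, IsMinimalStopping T A B Qs b Q S := by
  classical
  obtain ⟨K, jQ, hK, -⟩ := hQ.exists_index
  let P : ℕ → Prop := fun k =>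
    ∃ S ∈ stoppingCubes T A B Qs b, Q.toSet ⊆ S.toSet ∧ Qs.side = 2 ^ k * S.side
  have hP0 : P 0 :=
    ⟨Qs, mem_iUnion.mpr ⟨0, by simp [stoppingGeneration]⟩, hQ.subset_top, by simp⟩
  have hbd : ∀ k, P k → k ≤ K := by
    rintro k ⟨S, -, hQS, hk⟩
    by_contra! hc
    have h5 : (2 : ℝ) ^ K < 2 ^ k := pow_lt_pow_right₀ (by norm_num) hc
    have := mul_lt_mul h5 (Cube.side_le_of_subset hn hQS) Q.side_pos (by positivity)
    linarith
  obtain ⟨S, hS, hQS, hk⟩ := Nat.findGreatest_spec (P := P) (Nat.zero_le K) hP0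
  refine ⟨S, ⟨hS, hQS, fun R hR hQR => ?_⟩, fun S' hS' => ?_⟩
  · have dR := dyadic_of_mem_stoppingCubes T A B Qs b hR
    refine (dyadic_of_mem_stoppingCubes T A B Qs b hS).subset_of_le dR
      (hQS Q.corner_mem) (hQR Q.corner_mem) ?_
    obtain ⟨l, -, hl, -⟩ := dR.exists_index
    have hle : l ≤ Nat.findGreatest P K :=
      Nat.le_findGreatest (hbd l ⟨R, hR, hQR, hl⟩) ⟨R, hR, hQR, hl⟩
    by_contra! hc
    have h5 : (2 : ℝ) ^ l ≤ 2 ^ Nat.findGreatest P K := pow_le_pow_right₀ (by norm_num) hle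
    have := mul_lt_mul' h5 hc R.side_pos.le (by positivity)
    linarith
  · have dS := dyadic_of_mem_stoppingCubes T A B Qs b hS
    have dS' := dyadic_of_mem_stoppingCubes T A B Qs b hS'.1
    have h1 : S'.toSet ⊆ S.toSet := hS'.2.2 S hS hQS
    obtain ⟨l, -, hl, -⟩ := dS'.exists_index
    have hle : l ≤ Nat.findGreatest P K :=
      Nat.le_findGreatest (hbd l ⟨S', hS'.1, hS'.2.1, hl⟩) ⟨S', hS'.1, hS'.2.1, hl⟩
    have h2 : S.side ≤ S'.side := by
      by_contra! hc
      have h5 : (2 : ℝ) ^ l ≤ 2 ^ Nat.findGreatest P K := pow_le_pow_right₀ (by norm_num) hle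
      have := mul_lt_mul' h5 hc S'.side_pos.le (by positivity)
      linarith
    exact Cube.toSet_injective hn (h1.antisymm
      (dS.subset_of_le dS' (hQS Q.corner_mem) (hS'.2.1 Q.corner_mem) h2))

theorem stoppingAncestor_eq_iff (hn : 0 < n) {Q S : Cube n} (hQ : Qs.Dyadic Q) :
    stoppingAncestor T A B Qs b Q = S ↔ IsMinimalStopping T A B Qs b Q S := by
  have hu := existsUnique_isMinimalStopping T A B Qs b hn hQ
  have hs : IsMinimalStopping T A B Qs b Q (stoppingAncestor T A B Qs b Q) := by
    rw [stoppingAncestor, dif_pos hu.exists]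
    exact hu.exists.choose_spec
  exact ⟨fun h => h ▸ hs, fun h => hu.unique hs h⟩

end AncestorSpec

end TwistedMartingale

end

/-! By duality, everything reduces to the bound `∑ |⟨g, Δ_Q h⟩| ≤ C (‖h‖² + ‖g‖²)` over finite sets
of cubes with ancestor `F` (`IsTestFamily.sum_pairing_le`). Testing with a multiple of the finite
sum itself bounds that sum for all multipliers of modulus at most one
(`norm_sum_smul_sq_le_of_pairing`). In a Hilbert space such uniform bounds force unconditional
convergence (`summable_of_bounded_multipliers`).

A cube with ancestor `F` meets no stopping condition for `b_F`, so `|⟨b_F⟩_Q| ≥ 1/2` and `⟨|M_μ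
b_F|²⟩_Q` is bounded. Since `|b_F| ≤ M_μ b_F` almost everywhere and Besicovitch's covering theorem
bounds `‖M_μ‖` by a dimensional constant, `⟨|b_F|²⟩_Q ≤ K` with `K` depending on `n` and `A` only.

Call a child good if it has positive measure and ancestor `F`; any other child is null or is its own
ancestor. On good children the pairing becomes a product of two oscillations: that of the averages
of `h` and that of the averages of `b_F ḡ`, each corrected by the oscillation of the averages of
`b_F` (`norm_twisted_pairing_le`). It is thus controlled by square function increments of `h` and
`b_F ḡ`, by `α_Q (|⟨h⟩_Q|² + |⟨b_F ḡ⟩_Q|²)`, where `α_Q` collects the oscillation of `b_F` and the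
mass and `b_F`-energy of the bad children, and by the energies of `h` and `g` on bad children. The
function `b_F ḡ` need not be in `L²`; the inequality `|∫_Q b_F ḡ|² ≤ K μ(Q) ∫_Q |g|²` takes the
place of an `L²` bound.

All these terms are summed at once by a Bellman function: a nonnegative potential whose value at a
cube exceeds the sum of its values at the good children by at least the term at that cube
(`IsTestFamily.pairing_step`). The Carleson property of `α_Q` comes from a potential of the same
kind (`carlesonPotential_step`), which enters the denominator of the main one as in the Bellman
proof of Carleson embedding (`carleson_step`). -/

noncomputable section

namespace TwistedMartingale

/-! ### The centred maximal function on `L²(μ)`: Besicovitch covering, interpolation,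
differentiation. -/

section MaximalInequality

variable {n : ℕ} {μ : Measure (EuclideanSpace ℝ (Fin n))}

open Metric Filter Topology in
/-- Weak type `(1,1)` estimate for the centred maximal function with radii at most `R`. -/
theorem mul_measure_truncated_maximal_le {N : ℕ} {τ : ℝ} (hτ : 1 < τ)
    (hN : IsEmpty (Besicovitch.SatelliteConfig (EuclideanSpace ℝ (Fin n)) N τ))
    (f : EuclideanSpace ℝ (Fin n) → ℝ≥0∞) (t : ℝ≥0∞) (R : ℝ) :
    t * μ {x | ∃ r, 0 < r ∧ r ≤ R ∧ t * μ (ball x r) ≤ ∫⁻ y in ball x r, f y ∂μ}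
      ≤ N * ∫⁻ y, f y ∂μ := by
  set E := {x | ∃ r, 0 < r ∧ r ≤ R ∧ t * μ (ball x r) ≤ ∫⁻ y in ball x r, f y ∂μ} with hE
  have hch : ∀ x : E, ∃ r, 0 < r ∧ r ≤ R ∧
      t * μ (ball (x : EuclideanSpace ℝ (Fin n)) r) ≤ ∫⁻ y in ball (x : _) r, f y ∂μ :=
    fun x => x.2
  choose r hr0 hrR hr using hch
  -- Besicovitch covering needs bounded radii, hence the truncation at `R`. It yields `N` disjoint
  -- families whose balls together cover `E`.
  let q : Besicovitch.BallPackage E (EuclideanSpace ℝ (Fin n)) :=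
    { c := fun x => x, r := r, rpos := hr0, r_bound := R, r_le := hrR }
  obtain ⟨s, hs, hcov⟩ := Besicovitch.exist_disjoint_covering_families hτ hN q
  have hcount : ∀ i, (s i).Countable := fun i =>
    (hs i).countable_of_nonempty_interior fun x _ =>
      ⟨x, ball_subset_interior_closedBall (mem_ball_self (hr0 x))⟩
  have hdisj : ∀ i, (s i).PairwiseDisjoint fun j : E =>
      ball (j : EuclideanSpace ℝ (Fin n)) (r j) := fun i =>
    (hs i).mono fun x => ball_subset_closedBall
  have hsub : E ⊆ ⋃ i : Fin N, ⋃ j ∈ s i, ball (j : EuclideanSpace ℝ (Fin n)) (r j) := by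
    intro x hx
    exact hcov ⟨⟨x, hx⟩, rfl⟩
  calc t * μ E ≤ t * ∑ i : Fin N, μ (⋃ j ∈ s i, ball (j : EuclideanSpace ℝ (Fin n)) (r j)) := by
        gcongr
        exact (measure_mono hsub).trans (measure_iUnion_fintype_le _ _)
    _ = ∑ i : Fin N, t * μ (⋃ j ∈ s i, ball (j : EuclideanSpace ℝ (Fin n)) (r j)) :=
        Finset.mul_sum _ _ _
    _ ≤ ∑ i : Fin N, ∫⁻ y, f y ∂μ := by
        refine Finset.sum_le_sum fun i _ => ?_
        rw [measure_biUnion (hcount i) (hdisj i) fun _ _ => measurableSet_ball,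
          ← ENNReal.tsum_mul_left]
        refine (ENNReal.tsum_le_tsum fun j : s i => hr j).trans ?_
        rw [← lintegral_biUnion (hcount i) (fun _ _ => measurableSet_ball) (hdisj i)]
        exact setLIntegral_le_lintegral _ _
    _ = N * ∫⁻ y, f y ∂μ := by simp

open Metric Filter Topology in
/-- Weak type `(1,1)` estimate for the centred maximal function. -/
theorem mul_measure_maximal_le {N : ℕ} {τ : ℝ} (hτ : 1 < τ)
    (hN : IsEmpty (Besicovitch.SatelliteConfig (EuclideanSpace ℝ (Fin n)) N τ))
    (f : EuclideanSpace ℝ (Fin n) → ℝ≥0∞) (t : ℝ≥0∞) :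
    t * μ {x | ∃ r, 0 < r ∧ t * μ (ball x r) ≤ ∫⁻ y in ball x r, f y ∂μ}
      ≤ N * ∫⁻ y, f y ∂μ := by
  have hU : {x | ∃ r, 0 < r ∧ t * μ (ball x r) ≤ ∫⁻ y in ball x r, f y ∂μ} =
      ⋃ k : ℕ, {x | ∃ r, 0 < r ∧ r ≤ (k : ℝ) ∧ t * μ (ball x r) ≤ ∫⁻ y in ball x r, f y ∂μ} := by
    ext x
    simp only [mem_ofPred_eq, mem_iUnion]
    constructor
    · rintro ⟨r, h1, h2⟩
      obtain ⟨k, hk⟩ := exists_nat_ge r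
      exact ⟨k, r, h1, hk, h2⟩
    · rintro ⟨k, r, h1, -, h2⟩
      exact ⟨r, h1, h2⟩
  have hmono : Monotone fun k : ℕ => {x | ∃ r, 0 < r ∧ r ≤ (k : ℝ) ∧
      t * μ (ball x r) ≤ ∫⁻ y in ball x r, f y ∂μ} := by
    intro k l hkl x
    rintro ⟨r, h1, h2, h3⟩
    exact ⟨r, h1, h2.trans (by exact_mod_cast hkl), h3⟩
  rw [hU, hmono.measure_iUnion, ENNReal.mul_iSup]
  exact iSup_le fun k => mul_measure_truncated_maximal_le hτ hN f t k

open Metric in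
/-- Averages of `f` are controlled by the large values of `f`: where the maximal function of `f`
exceeds `t`, that of `f 1_{f > t/2}` is at least `t/2`. -/
theorem half_mul_measure_ball_le [IsLocallyFiniteMeasure μ]
    {f : EuclideanSpace ℝ (Fin n) → ℝ≥0∞} (hf : Measurable f) {t : ℝ≥0∞}
    (ht : t ≠ ∞) {x : EuclideanSpace ℝ (Fin n)} {r : ℝ}
    (h : t < (∫⁻ y in ball x r, f y ∂μ) / μ (ball x r)) :
    t / 2 * μ (ball x r) ≤ ∫⁻ y in ball x r, {z | t / 2 < f z}.indicator f y ∂μ := by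
  have hfin : μ (ball x r) ≠ ∞ := measure_ball_lt_top.ne
  have hb := ENNReal.mul_le_of_le_div h.le
  have hms : MeasurableSet {z | t / 2 < f z} := measurableSet_lt measurable_const hf
  have hpt : ∀ y, f y ≤ {z | t / 2 < f z}.indicator f y + t / 2 := by
    intro y
    by_cases hy : t / 2 < f y
    · rw [indicator_of_mem (by exact hy)]; exact le_self_add
    · rw [indicator_of_notMem (by exact hy)]; simpa using hy
  have h2 : ∫⁻ y in ball x r, f y ∂μ ≤
      ∫⁻ y in ball x r, {z | t / 2 < f z}.indicator f y ∂μ + t / 2 * μ (ball x r) := by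
    refine (lintegral_mono hpt).trans ?_
    rw [lintegral_add_left (hf.indicator hms), setLIntegral_const]
  have h3 : t / 2 * μ (ball x r) + t / 2 * μ (ball x r) ≤
      ∫⁻ y in ball x r, {z | t / 2 < f z}.indicator f y ∂μ + t / 2 * μ (ball x r) := by
    rw [← add_mul, ENNReal.add_halves]
    exact hb.trans h2
  refine (ENNReal.add_le_add_iff_right ?_).1 h3
  exact ENNReal.mul_ne_top (ENNReal.div_ne_top ht (by norm_num)) hfin

open Metric in
-- Only the part of `f` above `t/2` matters at level `t`. Keeping this cutoff on the right is what
-- makes the weak type estimate integrable against `t dt`, as in Marcinkiewicz interpolation.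
theorem mul_measure_lt_maximal_le [IsLocallyFiniteMeasure μ] {N : ℕ} {τ : ℝ} (hτ : 1 < τ)
    (hN : IsEmpty (Besicovitch.SatelliteConfig (EuclideanSpace ℝ (Fin n)) N τ))
    {f : EuclideanSpace ℝ (Fin n) → ℂ} (hf : Measurable f) {t : ℝ≥0∞} (ht : t ≠ ∞) :
    t * μ {x | t < maximalFunction μ f x} ≤
      2 * N * ∫⁻ y, {z | t < 2 * ‖f z‖ₑ}.indicator (fun z => ‖f z‖ₑ) y ∂μ := by
  have hsub : {x | t < maximalFunction μ f x} ⊆ {x | ∃ r, 0 < r ∧ t / 2 * μ (ball x r) ≤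
      ∫⁻ y in ball x r, {z | t / 2 < ‖f z‖ₑ}.indicator (fun z => ‖f z‖ₑ) y ∂μ} := by
    intro x hx
    obtain ⟨r, hr⟩ := lt_iSup_iff.1 (show t < maximalFunction μ f x from hx)
    obtain ⟨hr0, hr⟩ := lt_iSup_iff.1 hr
    exact ⟨r, hr0, half_mul_measure_ball_le hf.enorm ht hr⟩
  have hset : {z | t < 2 * ‖f z‖ₑ} = {z | t / 2 < ‖f z‖ₑ} := by
    ext z
    simp only [mem_ofPred_eq]
    rw [ENNReal.div_lt_iff (by norm_num) (by norm_num), mul_comm]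
  calc t * μ {x | t < maximalFunction μ f x}
      = 2 * (t / 2 * μ {x | t < maximalFunction μ f x}) := by
        rw [← mul_assoc, ENNReal.mul_div_cancel (by norm_num) (by norm_num)]
    _ ≤ 2 * (N * ∫⁻ y, {z | t / 2 < ‖f z‖ₑ}.indicator (fun z => ‖f z‖ₑ) y ∂μ) := by
        refine mul_le_mul_right (le_trans ?_ (mul_measure_maximal_le hτ hN _ (t / 2))) _
        exact mul_le_mul_right (measure_mono hsub) _
    _ = _ := by rw [hset, mul_assoc]

/-- Strong type `(2,2)` estimate for the centred maximal function. -/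
theorem lintegral_maximal_sq_le [IsLocallyFiniteMeasure μ] {N : ℕ} {τ : ℝ} (hτ : 1 < τ)
    (hN : IsEmpty (Besicovitch.SatelliteConfig (EuclideanSpace ℝ (Fin n)) N τ))
    {f : EuclideanSpace ℝ (Fin n) → ℂ} (hf : Measurable f) :
    ∫⁻ x, maximalFunction μ f x ^ 2 ∂μ ≤ 8 * N * ∫⁻ x, ‖f x‖ₑ ^ 2 ∂μ := by
  -- Testing with simple functions `φ` below the integrand avoids any measurability question for the
  -- maximal function; the layer cake formula is applied to `√φ`.
  rw [lintegral_eq_nnreal]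
  refine iSup₂_le fun φ hφ => ?_
  set g : EuclideanSpace ℝ (Fin n) → ℝ := fun x => Real.sqrt (φ x) with hg
  have hgm : Measurable g := by
    have := φ.measurable
    fun_prop
  have hgM : ∀ x, ENNReal.ofReal (g x) ≤ maximalFunction μ f x := by
    intro x
    have h1 : ENNReal.ofReal (g x) ^ 2 ≤ maximalFunction μ f x ^ 2 := by
      rw [← ENNReal.ofReal_pow (Real.sqrt_nonneg _), Real.sq_sqrt (φ x).coe_nonneg]
      simpa using hφ x
    exact (ENNReal.pow_le_pow_left_iff two_ne_zero).1 h1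
  have h1 : (φ.map ((↑) : ℝ≥0 → ℝ≥0∞)).lintegral μ = ∫⁻ x, ENNReal.ofReal (g x ^ (2 : ℝ)) ∂μ := by
    rw [← SimpleFunc.lintegral_eq_lintegral]
    refine lintegral_congr fun x => ?_
    have : g x ^ 2 = φ x := Real.sq_sqrt (φ x).coe_nonneg
    rw [Real.rpow_two, this]
    simp
  rw [h1, lintegral_rpow_eq_lintegral_meas_lt_mul μ (Filter.Eventually.of_forall fun x =>
    Real.sqrt_nonneg _) hgm.aemeasurable (by norm_num)]
  have h2 : ∀ t ∈ Ioi (0 : ℝ), μ {a | t < g a} * ENNReal.ofReal (t ^ ((2 : ℝ) - 1)) ≤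
      2 * N * ∫⁻ y, {z | ENNReal.ofReal t < 2 * ‖f z‖ₑ}.indicator (fun z => ‖f z‖ₑ) y ∂μ := by
    intro t ht
    refine le_trans ?_ (mul_measure_lt_maximal_le hτ hN hf (ENNReal.ofReal_ne_top (r := t)))
    rw [mul_comm, show (2 : ℝ) - 1 = 1 by norm_num, Real.rpow_one]
    gcongr with a
    intro hta
    exact ((ENNReal.ofReal_lt_ofReal_iff (lt_trans ht hta)).2 hta).trans_le (hgM a)
  have hmeas : Measurable (Function.uncurry fun (t : ℝ) y =>
      {z | ENNReal.ofReal t < 2 * ‖f z‖ₑ}.indicator (fun z => ‖f z‖ₑ) y) := by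
    have : (Function.uncurry fun (t : ℝ) y =>
        {z | ENNReal.ofReal t < 2 * ‖f z‖ₑ}.indicator (fun z => ‖f z‖ₑ) y) =
        {p : ℝ × EuclideanSpace ℝ (Fin n) | ENNReal.ofReal p.1 < 2 * ‖f p.2‖ₑ}.indicator
          fun p => ‖f p.2‖ₑ := by
      ext ⟨t, y⟩
      simp [indicator]
    rw [this]
    exact (by fun_prop : Measurable fun p : ℝ × EuclideanSpace ℝ (Fin n) => ‖f p.2‖ₑ).indicator
      (measurableSet_lt (by fun_prop) (by fun_prop))
  -- After Tonelli, the level `t` runs over `(0, 2|f y|)`. The constant `8 N` is 2 from the layer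
  -- cake, `2 N` from the weak type bound, and 2 from this length.
  have h3 : ∀ y, ∫⁻ t in Ioi (0 : ℝ),
      {z | ENNReal.ofReal t < 2 * ‖f z‖ₑ}.indicator (fun z => ‖f z‖ₑ) y = 2 * ‖f y‖ₑ ^ 2 := by
    intro y
    have : ∀ t : ℝ, t ∈ Ioi (0 : ℝ) →
        {z | ENNReal.ofReal t < 2 * ‖f z‖ₑ}.indicator (fun z => ‖f z‖ₑ) y =
        (Iio (2 * ‖f y‖)).indicator (fun _ => ‖f y‖ₑ) t := by
      intro t ht
      have : ENNReal.ofReal t < 2 * ‖f y‖ₑ ↔ t < 2 * ‖f y‖ := by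
        rw [← ofReal_norm, ← ENNReal.ofReal_ofNat, ← ENNReal.ofReal_mul (by norm_num)]
        rw [ENNReal.ofReal_lt_ofReal_iff']
        constructor
        · exact fun h => h.1
        · exact fun h => ⟨h, lt_trans ht h⟩
      simp [indicator, this]
    rw [setLIntegral_congr_fun measurableSet_Ioi this, lintegral_indicator measurableSet_Iio,
      Measure.restrict_restrict measurableSet_Iio, setLIntegral_const, Iio_inter_Ioi,
      Real.volume_Ioo, sub_zero, ENNReal.ofReal_mul (by norm_num), ofReal_norm]
    simp only [ENNReal.ofReal_ofNat]
    ring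
  calc ENNReal.ofReal 2 * ∫⁻ t in Ioi (0 : ℝ), μ {a | t < g a} *
        ENNReal.ofReal (t ^ ((2 : ℝ) - 1))
      ≤ ENNReal.ofReal 2 * ∫⁻ t in Ioi (0 : ℝ), 2 * N *
        ∫⁻ y, {z | ENNReal.ofReal t < 2 * ‖f z‖ₑ}.indicator (fun z => ‖f z‖ₑ) y ∂μ := by
        gcongr 1
        exact setLIntegral_mono' measurableSet_Ioi h2
    _ = ENNReal.ofReal 2 * (2 * N * ∫⁻ y, 2 * ‖f y‖ₑ ^ 2 ∂μ) := by
        rw [lintegral_const_mul' _ _ (ENNReal.mul_ne_top (by norm_num) (by simp)),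
          lintegral_lintegral_swap hmeas.aemeasurable]
        simp only [h3]
    _ = 8 * N * ∫⁻ x, ‖f x‖ₑ ^ 2 ∂μ := by
        rw [lintegral_const_mul' _ _ (by norm_num), ENNReal.ofReal_ofNat]
        ring

theorem mem_maximal_bounds [IsLocallyFiniteMeasure μ] {N : ℕ} {τ : ℝ} (hτ : 1 < τ)
    (hN : IsEmpty (Besicovitch.SatelliteConfig (EuclideanSpace ℝ (Fin n)) N τ)) :
    (8 * N : ℝ≥0∞) ∈ {c : ℝ≥0∞ | ∀ h : Lp ℂ 2 μ,
      ∫⁻ x, maximalFunction μ h x ^ 2 ∂μ ≤ c ^ 2 * ∫⁻ x, ‖h x‖ₑ ^ 2 ∂μ} := by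
  intro h
  refine (lintegral_maximal_sq_le hτ hN (Lp.stronglyMeasurable h).measurable).trans ?_
  gcongr
  -- The strong type bound provides `8 N` where `c ^ 2` is required; for a natural number the square
  -- is no smaller, so no root is needed.
  have : ((8 * N : ℕ) : ℝ≥0∞) ≤ ((8 * N) ^ 2 : ℕ) :=
    Nat.cast_le.2 (Nat.le_self_pow two_ne_zero _)
  push_cast at this
  exact this

/-- The maximal function is bounded on `L²(μ)`, with a norm that depends only on the dimension. -/
theorem exists_maximalNorm_le (n : ℕ) : ∃ N : ℕ, ∀ (μ : Measure (EuclideanSpace ℝ (Fin n)))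
    [IsLocallyFiniteMeasure μ], maximalNorm μ ≤ N := by
  obtain ⟨N, τ, hτ, hN⟩ := HasBesicovitchCovering.no_satelliteConfig
    (α := EuclideanSpace ℝ (Fin n))
  refine ⟨8 * N, fun μ _ => ?_⟩
  push_cast
  exact sInf_le (mem_maximal_bounds hτ hN)

/-- The infimum that defines `‖M_μ‖` is attained. -/
theorem lintegral_maximal_sq_le_maximalNorm [IsLocallyFiniteMeasure μ] (h : Lp ℂ 2 μ) :
    ∫⁻ x, maximalFunction μ h x ^ 2 ∂μ ≤ maximalNorm μ ^ 2 * ∫⁻ x, ‖h x‖ₑ ^ 2 ∂μ := by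
  have hX : ∫⁻ x, ‖h x‖ₑ ^ 2 ∂μ ≠ ∞ := by
    simpa using (lintegral_rpow_enorm_lt_top_of_eLpNorm_lt_top (p := 2) (by norm_num)
      (by norm_num) (Lp.memLp h).eLpNorm_lt_top).ne
  -- For each fixed `h` of finite energy the admissible constants form a closed set, so the infimum
  -- is still admissible.
  have hcont : Continuous fun c : ℝ≥0∞ => c ^ 2 * ∫⁻ x, ‖h x‖ₑ ^ 2 ∂μ :=
    (ENNReal.continuous_mul_const hX).comp (ENNReal.continuous_pow 2)
  have hmem : maximalNorm μ ∈ closure {c : ℝ≥0∞ | ∀ h : Lp ℂ 2 μ,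
      ∫⁻ x, maximalFunction μ h x ^ 2 ∂μ ≤ c ^ 2 * ∫⁻ x, ‖h x‖ₑ ^ 2 ∂μ} := by
    obtain ⟨N, τ, hτ, hN⟩ := HasBesicovitchCovering.no_satelliteConfig
      (α := EuclideanSpace ℝ (Fin n))
    exact csInf_mem_closure ⟨_, mem_maximal_bounds hτ hN⟩ (OrderBot.bddBelow _)
  have hcl := isClosed_le (f := fun _ => ∫⁻ x, maximalFunction μ h x ^ 2 ∂μ) continuous_const hcont
  exact closure_minimal (fun c (hc : ∀ h : Lp ℂ 2 μ, _ ≤ _) => hc h) hcl hmem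

open Metric Filter Topology in
-- A closed ball is the decreasing intersection of slightly larger open balls of finite measure.
-- This links the differentiation theorem, which uses closed balls, with the maximal function, which
-- uses open ones.
theorem lintegral_closedBall_le_maximal [IsLocallyFiniteMeasure μ]
    (f : EuclideanSpace ℝ (Fin n) → ℂ) (x : EuclideanSpace ℝ (Fin n)) {ρ : ℝ} (hρ : 0 < ρ) :
    (∫⁻ y in closedBall x ρ, ‖f y‖ₑ ∂μ) / μ (closedBall x ρ) ≤ maximalFunction μ f x := by
  by_cases hM : maximalFunction μ f x = ∞
  · rw [hM]; exact le_top
  refine ENNReal.div_le_of_le_mul ?_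
  have hlim : Tendsto (fun k : ℕ => maximalFunction μ f x * μ (ball x (ρ + 1 / (k + 1)))) atTop
      (𝓝 (maximalFunction μ f x * μ (closedBall x ρ))) := by
    refine ENNReal.Tendsto.const_mul ?_ (Or.inr hM)
    have hI : closedBall x ρ = ⋂ k : ℕ, ball x (ρ + 1 / ((k : ℝ) + 1)) := by
      ext y
      simp only [mem_closedBall, mem_iInter, mem_ball]
      constructor
      · intro h k
        have : 0 < 1 / ((k : ℝ) + 1) := by positivity
        linarith
      · intro h
        refine le_of_forall_pos_le_add fun ε hε => ?_
        obtain ⟨k, hk⟩ := exists_nat_one_div_lt hε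
        linarith [h k]
    rw [hI]
    refine tendsto_measure_iInter_atTop (fun k => measurableSet_ball.nullMeasurableSet) ?_
      ⟨0, measure_ball_lt_top.ne⟩
    intro k l hkl
    refine ball_subset_ball ?_
    have := Nat.one_div_le_one_div (α := ℝ) hkl
    linarith
  refine ge_of_tendsto' hlim fun k => ?_
  have hk : 0 < 1 / ((k : ℝ) + 1) := by positivity
  have h1 : (∫⁻ y in ball x (ρ + 1 / (k + 1)), ‖f y‖ₑ ∂μ) / μ (ball x (ρ + 1 / (k + 1)))
      ≤ maximalFunction μ f x :=
    le_iSup₂ (f := fun (r : ℝ) (_ : 0 < r) => (∫⁻ y in ball x r, ‖f y‖ₑ ∂μ) / μ (ball x r))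
      (ρ + 1 / (k + 1)) (by linarith)
  refine (lintegral_mono_set (closedBall_subset_ball
    (show ρ < ρ + 1 / ((k : ℝ) + 1) by linarith))).trans ?_
  by_cases h0 : μ (ball x (ρ + 1 / (k + 1))) = 0
  · rw [setLIntegral_measure_zero _ _ h0]; exact zero_le
  · exact (ENNReal.div_le_iff h0 measure_ball_lt_top.ne).1 h1

open Filter in
/-- Lebesgue differentiation: a function is dominated by its maximal function. -/
theorem enorm_le_maximalFunction [IsLocallyFiniteMeasure μ]
    {f : EuclideanSpace ℝ (Fin n) → ℂ} (hf : AEMeasurable f μ) (hfi : ∫⁻ y, ‖f y‖ₑ ∂μ ≠ ∞) :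
    ∀ᵐ x ∂μ, ‖f x‖ₑ ≤ maximalFunction μ f x := by
  filter_upwards [(Besicovitch.vitaliFamily μ).ae_tendsto_lintegral_div hf.enorm hfi] with x hx
  refine le_of_tendsto (hx.comp (Besicovitch.tendsto_filterAt μ x)) ?_
  filter_upwards [self_mem_nhdsWithin] with r hr
  exact lintegral_closedBall_le_maximal f x hr

end MaximalInequality

/-! ### Inequalities at a single cube and its children; `G` is the set of good children. -/

section NodeEstimates

variable {ι : Type*} [Fintype ι] [DecidableEq ι] {G : Finset ι}

/-- The arithmetic-geometric mean inequality, with its hypothesis in the form delivered by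
Cauchy–Schwarz. It absorbs the cross terms over bad children. -/
theorem two_mul_mul_le_of_sq_le {a x p q : ℝ} (hp : 0 ≤ p) (hq : 0 ≤ q) (h : x ^ 2 ≤ p * q) :
    2 * a * x ≤ a ^ 2 * p + q := by
  have h0 : 0 ≤ a ^ 2 * p + q := by positivity
  refine le_of_sq_le_sq ?_ h0
  nlinarith [sq_nonneg (a ^ 2 * p - q), mul_le_mul_of_nonneg_left h (sq_nonneg a)]

/-- The oscillation of the averages over the good children, for a sum `Z` distributed over the
children. -/
theorem sum_norm_sub_sq_le {m : ℝ} {mc : ι → ℝ} {Z : ℂ} {Zc : ι → ℂ} (hm : 0 < m)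
    (hmc : ∀ s, 0 ≤ mc s) (hmG : ∀ s ∈ G, 0 < mc s) (hmsum : ∑ s, mc s = m)
    (hZsum : ∑ s, Zc s = Z) :
    ∑ s ∈ G, ‖Zc s / mc s - Z / m‖ ^ 2 * mc s ≤
      ∑ s ∈ G, ‖Zc s‖ ^ 2 / mc s - ‖Z‖ ^ 2 / m + 2 * ‖Z / m‖ * ∑ s ∈ Gᶜ, ‖Zc s‖ := by
  have hterm : ∀ s ∈ G, ‖Zc s / mc s - Z / m‖ ^ 2 * mc s =
      ‖Zc s‖ ^ 2 / mc s - 2 * inner ℝ (Zc s) (Z / m) + ‖Z / m‖ ^ 2 * mc s := by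
    intro s hs
    have hs0 := (hmG s hs).ne'
    have h1 : Zc s / (mc s : ℂ) = (mc s)⁻¹ • Zc s := by
      rw [Complex.real_smul]; push_cast; ring
    rw [norm_sub_sq_real, h1, norm_smul, real_inner_smul_left, Real.norm_eq_abs, mul_pow,
      sq_abs]
    field_simp
  -- For a full set of children this would be the usual variance identity; the missing children
  -- leave the error term.
  have hin : ∑ s ∈ G, inner ℝ (Zc s) (Z / m) =
      ‖Z‖ ^ 2 / m - ∑ s ∈ Gᶜ, inner ℝ (Zc s) (Z / m) := by
    rw [eq_sub_iff_add_eq, Finset.sum_add_sum_compl, ← sum_inner, hZsum]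
    have h1 : Z / (m : ℂ) = m⁻¹ • Z := by
      rw [Complex.real_smul]; push_cast; ring
    rw [h1, real_inner_smul_right, real_inner_self_eq_norm_sq]
    ring
  have hbad : ∑ s ∈ Gᶜ, inner ℝ (Zc s) (Z / m) ≤ ‖Z / m‖ * ∑ s ∈ Gᶜ, ‖Zc s‖ := by
    rw [Finset.mul_sum]
    refine Finset.sum_le_sum fun s _ => ?_
    rw [mul_comm]
    exact real_inner_le_norm _ _
  have hmG' : ∑ s ∈ G, mc s ≤ m := by
    rw [← hmsum]
    exact Finset.sum_le_sum_of_subset_of_nonneg (Finset.subset_univ _) fun s _ _ => hmc s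
  have hz : ‖Z / m‖ ^ 2 * m = ‖Z‖ ^ 2 / m := by
    rw [norm_div, Complex.norm_real, Real.norm_eq_abs, abs_of_pos hm]
    field_simp
  rw [Finset.sum_congr rfl hterm, Finset.sum_add_distrib, Finset.sum_sub_distrib,
    ← Finset.mul_sum, ← Finset.mul_sum, hin]
  nlinarith [mul_le_mul_of_nonneg_left hmG' (sq_nonneg ‖Z / m‖)]

/-- The Bellman function step of the Carleson embedding theorem. -/
theorem carleson_step {m α Λ L : ℝ} {mc Λc : ι → ℝ} {Z : ℂ} {Zc : ι → ℂ} {σc ηc : ι → ℝ}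
    (hm : 0 < m) (hmc : ∀ s, 0 ≤ mc s) (hmG : ∀ s ∈ G, 0 < mc s) (hmsum : ∑ s, mc s = m)
    (hZsum : ∑ s, Zc s = Z) (hα : 0 ≤ α) (hΛc : ∀ s ∈ G, 0 ≤ Λc s)
    (hΛ : α + ∑ s ∈ G, Λc s ≤ Λ) (hΛL : Λ ≤ L * m) (hL : 0 ≤ L)
    (hσ : ∀ s, 0 ≤ σc s) (hη : ∀ s, 0 ≤ ηc s) (hZc : ∀ s ∈ Gᶜ, ‖Zc s‖ ^ 2 ≤ σc s * ηc s)
    (hσα : ∑ s ∈ Gᶜ, σc s ≤ α) {c : ℝ} (hc : c = 2 * (1 + L) ^ 2) :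
    α * ‖Z / m‖ ^ 2 + c * (‖Z‖ ^ 2 / (m + Λ)) ≤
      c ^ 2 * ∑ s ∈ Gᶜ, ηc s + c * ∑ s ∈ G, ‖Zc s‖ ^ 2 / (mc s + Λc s) := by
  have hc0 : 0 ≤ c := by rw [hc]; positivity
  have hΛG : 0 ≤ ∑ s ∈ G, Λc s := Finset.sum_nonneg hΛc
  have hmG' : ∑ s ∈ G, mc s ≤ m := by
    rw [← hmsum]
    exact Finset.sum_le_sum_of_subset_of_nonneg (Finset.subset_univ _) fun s _ _ => hmc s
  -- `D'` bounds the sum of the denominators over the good children. The gap `α` between `D'` and `m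
  -- + Λ` is the gain of the Bellman function.
  set D' := m + Λ - α with hD'
  have hD'm : m ≤ D' := by linarith
  have hD'0 : 0 < D' := by linarith
  have hD0 : 0 < m + Λ := by linarith
  set Wg := ∑ s ∈ G, ‖Zc s‖ with hWg
  set Wb := ∑ s ∈ Gᶜ, ‖Zc s‖ with hWb
  have hWg0 : 0 ≤ Wg := Finset.sum_nonneg fun _ _ => norm_nonneg _
  have hWb0 : 0 ≤ Wb := Finset.sum_nonneg fun _ _ => norm_nonneg _
  have hW : ‖Z‖ ≤ Wg + Wb := by
    rw [← hZsum, hWg, hWb, Finset.sum_add_sum_compl]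
    exact norm_sum_le _ _
  have hsed : Wg ^ 2 / D' ≤ ∑ s ∈ G, ‖Zc s‖ ^ 2 / (mc s + Λc s) := by
    rcases G.eq_empty_or_nonempty with rfl | hne
    · simp [hWg]
    · have hpos : ∀ s ∈ G, 0 < mc s + Λc s := fun s hs => by linarith [hmG s hs, hΛc s hs]
      refine le_trans ?_ (Finset.sq_sum_div_le_sum_sq_div G (fun s => ‖Zc s‖) hpos)
      refine div_le_div_of_nonneg_left (sq_nonneg _) (Finset.sum_pos hpos hne) ?_
      rw [Finset.sum_add_distrib]
      linarith
  have hz : ‖Z / m‖ = ‖Z‖ / m := by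
    rw [norm_div, Complex.norm_real, Real.norm_eq_abs, abs_of_pos hm]
  set W := ‖Z‖ with hWdef
  have hW0 : 0 ≤ W := norm_nonneg _
  have hbad : 2 * (W / m) * (c * Wb) ≤ (W / m) ^ 2 * α + c ^ 2 * ∑ s ∈ Gᶜ, ηc s := by
    calc 2 * (W / m) * (c * Wb) = ∑ s ∈ Gᶜ, 2 * (W / m) * (c * ‖Zc s‖) := by
          rw [hWb, Finset.mul_sum, Finset.mul_sum]
      _ ≤ ∑ s ∈ Gᶜ, ((W / m) ^ 2 * σc s + c ^ 2 * ηc s) := by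
          refine Finset.sum_le_sum fun s hs => two_mul_mul_le_of_sq_le (hσ s)
            (mul_nonneg (sq_nonneg _) (hη s)) ?_
          rw [mul_pow]
          nlinarith [mul_le_mul_of_nonneg_left (hZc s hs) (sq_nonneg c)]
      _ = (W / m) ^ 2 * ∑ s ∈ Gᶜ, σc s + c ^ 2 * ∑ s ∈ Gᶜ, ηc s := by
          rw [Finset.sum_add_distrib, Finset.mul_sum, Finset.mul_sum]
      _ ≤ _ := by gcongr
  -- From `W ≤ Wg + Wb`. If `W ≤ Wb` the left side is not positive; otherwise square `W - Wb ≤ Wg`.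
  have hsq : W ^ 2 - 2 * W * Wb ≤ Wg ^ 2 := by
    by_cases hcase : W ≤ Wb
    · nlinarith [sq_nonneg Wg]
    · nlinarith [mul_self_le_mul_self (by linarith : 0 ≤ W - Wb) (by linarith : W - Wb ≤ Wg),
        sq_nonneg Wb]
  have h1 : W ^ 2 / D' - 2 * (W / m) * Wb ≤ Wg ^ 2 / D' := by
    have h2 : 2 * W * Wb / D' ≤ 2 * W * Wb / m :=
      div_le_div_of_nonneg_left (by positivity) hm hD'm
    have h3 : (W ^ 2 - 2 * W * Wb) / D' ≤ Wg ^ 2 / D' := by gcongr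
    rw [sub_div] at h3
    have h4 : 2 * (W / m) * Wb = 2 * W * Wb / m := by ring
    linarith
  -- Both denominators are at most `(1 + L) m`, which fixes `c = 2 (1 + L) ^ 2`. One copy of `α (W /
  -- m) ^ 2` is the term to be dominated, the other absorbs the bad children in `hbad`.
  have h2 : 2 * (α * (W / m) ^ 2) ≤ c * (W ^ 2 / D' - W ^ 2 / (m + Λ)) := by
    have h3 : W ^ 2 / D' - W ^ 2 / (m + Λ) = W ^ 2 * α / (D' * (m + Λ)) := by
      field_simp
      rw [hD']
      ring
    have h4 : D' * (m + Λ) ≤ (1 + L) ^ 2 * m ^ 2 := by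
      have h5 : m + Λ ≤ (1 + L) * m := by linarith
      have h6 : D' ≤ (1 + L) * m := by linarith
      nlinarith [mul_le_mul h6 h5 hD0.le (by positivity)]
    have h7 : W ^ 2 * α / ((1 + L) ^ 2 * m ^ 2) ≤ W ^ 2 * α / (D' * (m + Λ)) :=
      div_le_div_of_nonneg_left (by positivity) (by positivity) h4
    have h8 : 2 * (α * (W / m) ^ 2) = c * (W ^ 2 * α / ((1 + L) ^ 2 * m ^ 2)) := by
      rw [hc]
      have : (1 + L) ≠ 0 := by positivity
      field_simp
    rw [h3, h8]
    gcongr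
  rw [hz]
  nlinarith [mul_le_mul_of_nonneg_left hsed hc0, mul_le_mul_of_nonneg_left h1 hc0]

/-- The potential that dominates the square function and the Carleson sum of `Z`. -/
def squarePotential (c M m Λ W η : ℝ) : ℝ :=
  -- The last term telescopes against the square function. The middle one yields two copies of `α |Z
  -- / m| ^ 2`: one for the Carleson sum, one for the cross term that bad children create in the
  -- square function. The first pays for the energy on bad children and keeps the whole nonnegative.
  M * η - 2 * c * (W ^ 2 / (m + Λ)) - W ^ 2 / m

/-- Needed where the tree is cut off. The factor `K` is 1 when `W` comes from `∫ h`, and the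
mean-square bound of the test function when it comes from `∫ b ḡ`. -/
theorem squarePotential_nonneg {c M m Λ W η K : ℝ} (hm : 0 < m) (hΛ : 0 ≤ Λ) (hc : 0 ≤ c)
    (hη : 0 ≤ η) (hW : W ^ 2 ≤ K * (m * η)) (hM : (2 * c + 1) * K ≤ M) :
    0 ≤ squarePotential c M m Λ W η := by
  have h1 : W ^ 2 / (m + Λ) ≤ W ^ 2 / m :=
    div_le_div_of_nonneg_left (sq_nonneg _) hm (by linarith)
  have h2 : W ^ 2 / m ≤ K * η := by
    rw [div_le_iff₀ hm]; linarith
  have h3 : (2 * c + 1) * (W ^ 2 / m) ≤ (2 * c + 1) * (K * η) := by gcongr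
  have h4 := mul_le_mul_of_nonneg_right hM hη
  have h5 := mul_le_mul_of_nonneg_left h1 hc
  rw [squarePotential]
  linarith

theorem squarePotential_le {c M m Λ W η : ℝ} (hm : 0 < m) (hΛ : 0 ≤ Λ) (hc : 0 ≤ c) :
    squarePotential c M m Λ W η ≤ M * η := by
  have : 0 ≤ 2 * c * (W ^ 2 / (m + Λ)) := by positivity
  have : 0 ≤ W ^ 2 / m := by positivity
  rw [squarePotential]
  linarith

/-- Twice `carleson_step` plus the oscillation inequality. The energy on bad children is then spent
`2 c ^ 2 + 2` times, which is the requirement on `M`. The weights `σc` are left free because the two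
applications use different Cauchy–Schwarz bounds on bad children. -/
theorem squarePotential_step {m α Λ L : ℝ} {mc Λc : ι → ℝ} {Z : ℂ} {Zc : ι → ℂ} {η : ℝ}
    {σc ηc : ι → ℝ}
    (hm : 0 < m) (hmc : ∀ s, 0 ≤ mc s) (hmG : ∀ s ∈ G, 0 < mc s) (hmsum : ∑ s, mc s = m)
    (hZsum : ∑ s, Zc s = Z) (hα : 0 ≤ α) (hΛc : ∀ s ∈ G, 0 ≤ Λc s)
    (hΛ : α + ∑ s ∈ G, Λc s ≤ Λ) (hΛL : Λ ≤ L * m) (hL : 0 ≤ L)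
    (hσ : ∀ s, 0 ≤ σc s) (hη : ∀ s, 0 ≤ ηc s) (hηsum : ∑ s, ηc s = η)
    (hZc : ∀ s ∈ Gᶜ, ‖Zc s‖ ^ 2 ≤ σc s * ηc s)
    (hσα : ∑ s ∈ Gᶜ, σc s ≤ α) {c M : ℝ} (hc : c = 2 * (1 + L) ^ 2) (hM : 2 * c ^ 2 + 2 ≤ M) :
    (∑ s ∈ G, ‖Zc s / mc s - Z / m‖ ^ 2 * mc s + α * ‖Z / m‖ ^ 2 + ∑ s ∈ Gᶜ, ηc s) +
      ∑ s ∈ G, squarePotential c M (mc s) (Λc s) ‖Zc s‖ (ηc s) ≤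
      squarePotential c M m Λ ‖Z‖ η := by
  have h1 := carleson_step hm hmc hmG hmsum hZsum hα hΛc hΛ hΛL hL hσ hη hZc hσα hc
  have h2 := sum_norm_sub_sq_le hm hmc hmG hmsum hZsum
  have hbad : 2 * ‖Z / m‖ * ∑ s ∈ Gᶜ, ‖Zc s‖ ≤ ‖Z / m‖ ^ 2 * α + ∑ s ∈ Gᶜ, ηc s := by
    calc 2 * ‖Z / m‖ * ∑ s ∈ Gᶜ, ‖Zc s‖ ≤ ∑ s ∈ Gᶜ, (‖Z / m‖ ^ 2 * σc s + ηc s) := by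
          rw [Finset.mul_sum]
          exact Finset.sum_le_sum fun s hs => two_mul_mul_le_of_sq_le (hσ s) (hη s) (hZc s hs)
      _ = ‖Z / m‖ ^ 2 * ∑ s ∈ Gᶜ, σc s + ∑ s ∈ Gᶜ, ηc s := by
          rw [Finset.sum_add_distrib, Finset.mul_sum]
      _ ≤ _ := by gcongr
  have hb0 : 0 ≤ ∑ s ∈ Gᶜ, ηc s := Finset.sum_nonneg fun s _ => hη s
  have hsplit : ∑ s ∈ G, ηc s + ∑ s ∈ Gᶜ, ηc s = η := by
    rw [Finset.sum_add_sum_compl, hηsum]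
  have h3 := mul_le_mul_of_nonneg_right hM hb0
  simp only [squarePotential, Finset.sum_sub_distrib, ← Finset.mul_sum]
  rw [← hsplit]
  nlinarith

/-- The coefficient of the Carleson sequence attached to the test function. -/
def carlesonCoefficient (G : Finset ι) (m : ℝ) (mc σc : ι → ℝ) (Z : ℂ) (Zc : ι → ℂ) : ℝ :=
  ∑ s ∈ Gᶜ, (mc s + σc s) + ∑ s ∈ G, ‖Zc s / mc s - Z / m‖ ^ 2 * mc s

theorem carlesonCoefficient_nonneg {m : ℝ} {mc σc : ι → ℝ} {Z : ℂ} {Zc : ι → ℂ}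
    (hmc : ∀ s, 0 ≤ mc s) (hσ : ∀ s, 0 ≤ σc s) :
    0 ≤ carlesonCoefficient G m mc σc Z Zc :=
  add_nonneg (Finset.sum_nonneg fun s _ => add_nonneg (hmc s) (hσ s))
    (Finset.sum_nonneg fun s _ => mul_nonneg (sq_nonneg _) (hmc s))

/-- The potential that dominates the Carleson sequence attached to the test function. -/
def carlesonPotential (K m σ W : ℝ) : ℝ := (K + 1) * m + 2 * σ - W ^ 2 / m

/-- The term `-W ^ 2 / m` pays for the oscillation. A bad child costs its mass and energy once in
the coefficient, and `K` times its mass plus its energy in the cross term; this gives the weights `K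
+ 1` and 2. -/
theorem carlesonPotential_step {K m σ : ℝ} {mc σc : ι → ℝ} {Z : ℂ} {Zc : ι → ℂ}
    (hm : 0 < m) (hmc : ∀ s, 0 ≤ mc s) (hmG : ∀ s ∈ G, 0 < mc s) (hmsum : ∑ s, mc s = m)
    (hZsum : ∑ s, Zc s = Z) (hσ : ∀ s, 0 ≤ σc s) (hσsum : ∑ s, σc s = σ)
    (hZc : ∀ s, ‖Zc s‖ ^ 2 ≤ mc s * σc s) (hZ : ‖Z / m‖ ^ 2 ≤ K) :
    carlesonCoefficient G m mc σc Z Zc +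
      ∑ s ∈ G, carlesonPotential K (mc s) (σc s) ‖Zc s‖ ≤ carlesonPotential K m σ ‖Z‖ := by
  have h2 := sum_norm_sub_sq_le hm hmc hmG hmsum hZsum
  have hb0 : 0 ≤ ∑ s ∈ Gᶜ, mc s := Finset.sum_nonneg fun s _ => hmc s
  have hbad : 2 * ‖Z / m‖ * ∑ s ∈ Gᶜ, ‖Zc s‖ ≤ K * ∑ s ∈ Gᶜ, mc s + ∑ s ∈ Gᶜ, σc s := by
    calc 2 * ‖Z / m‖ * ∑ s ∈ Gᶜ, ‖Zc s‖ ≤ ∑ s ∈ Gᶜ, (‖Z / m‖ ^ 2 * mc s + σc s) := by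
          rw [Finset.mul_sum]
          exact Finset.sum_le_sum fun s _ => two_mul_mul_le_of_sq_le (hmc s) (hσ s) (hZc s)
      _ = ‖Z / m‖ ^ 2 * ∑ s ∈ Gᶜ, mc s + ∑ s ∈ Gᶜ, σc s := by
          rw [Finset.sum_add_distrib, Finset.mul_sum]
      _ ≤ _ := by gcongr
  have hsplit : ∑ s ∈ G, σc s + ∑ s ∈ Gᶜ, σc s = σ := by
    rw [Finset.sum_add_sum_compl, hσsum]
  have hsplit' : ∑ s ∈ G, mc s + ∑ s ∈ Gᶜ, mc s = m := by
    rw [Finset.sum_add_sum_compl, hmsum]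
  simp only [carlesonPotential, carlesonCoefficient, Finset.sum_sub_distrib,
    Finset.sum_add_distrib, ← Finset.mul_sum]
  nlinarith [Finset.sum_nonneg fun s (_ : s ∈ G) => hσ s]

theorem carlesonPotential_nonneg {K m σ W : ℝ} (hm : 0 < m) (hK : 0 ≤ K) (hσ : 0 ≤ σ)
    (hW : W ^ 2 ≤ m * σ) : 0 ≤ carlesonPotential K m σ W := by
  have h2 : W ^ 2 / m ≤ σ := by
    rw [div_le_iff₀ hm]; linarith
  have : 0 ≤ K * m := by positivity
  rw [carlesonPotential]
  linarith

theorem carlesonPotential_le {K m σ W : ℝ} (hm : 0 < m) (hσ : σ ≤ K * m) :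
    carlesonPotential K m σ W ≤ (3 * K + 1) * m := by
  have : 0 ≤ W ^ 2 / m := by positivity
  rw [carlesonPotential]
  linarith

theorem two_mul_norm_mul_norm_le {a b c d : ℂ} {x y : ℝ} (ha : ‖a‖ ≤ ‖c‖ + 2 * x)
    (hb : ‖b‖ ≤ ‖d‖ + 2 * y) :
    2 * (‖a‖ * ‖b‖) ≤ 2 * ‖c‖ ^ 2 + 8 * x ^ 2 + 2 * ‖d‖ ^ 2 + 8 * y ^ 2 := by
  have h1 : ‖a‖ ^ 2 ≤ (‖c‖ + 2 * x) ^ 2 := by gcongr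
  have h2 : ‖b‖ ^ 2 ≤ (‖d‖ + 2 * y) ^ 2 := by gcongr
  nlinarith [sq_nonneg (‖a‖ - ‖b‖), sq_nonneg (‖c‖ - 2 * x), sq_nonneg (‖d‖ - 2 * y)]

/-- The twisted martingale difference at one node of the tree, paired with a function: `B`, `H` and
`Y` are the integrals of `b`, of `h` and of `b` against the dual function. -/
theorem norm_twisted_pairing_le {A m : ℝ} {mc σc ηc γc : ι → ℝ} {B H Y : ℂ} {Bc Hc Yc E : ι → ℂ}
    (hA : 0 ≤ A) (hm : 0 < m) (hmc : ∀ s, 0 ≤ mc s) (hmG : ∀ s ∈ G, 0 < mc s)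
    (hBsum : ∑ s, Bc s = B) (hHsum : ∑ s, Hc s = H)
    (hσ : ∀ s, 0 ≤ σc s) (hη : ∀ s, 0 ≤ ηc s) (hγ : ∀ s, 0 ≤ γc s)
    (hBc : ∀ s, ‖Bc s‖ ^ 2 ≤ mc s * σc s) (hHc : ∀ s, ‖Hc s‖ ^ 2 ≤ mc s * ηc s)
    (hYc : ∀ s, ‖Yc s‖ ^ 2 ≤ σc s * γc s) (hE : ∀ s ∈ Gᶜ, ‖E s‖ ^ 2 ≤ (A * ηc s) * γc s)
    (hB : 1 / 2 ≤ ‖B / m‖) (hBG : ∀ s ∈ G, 1 / 2 ≤ ‖Bc s / mc s‖) :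
    ‖∑ s ∈ G, ((Hc s / mc s) / (Bc s / mc s) - (H / m) / (B / m)) * Yc s +
        ∑ s ∈ Gᶜ, (E s - (H / m) / (B / m) * Yc s)‖ ≤
      (A + 8) * ((∑ s ∈ G, ‖Hc s / mc s - H / m‖ ^ 2 * mc s +
          carlesonCoefficient G m mc σc B Bc * ‖H / m‖ ^ 2 + ∑ s ∈ Gᶜ, ηc s) +
        (∑ s ∈ G, ‖Yc s / mc s - Y / m‖ ^ 2 * mc s +
          carlesonCoefficient G m mc σc B Bc * ‖Y / m‖ ^ 2 + ∑ s ∈ Gᶜ, γc s)) := by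
  set β := B / (m : ℂ) with hβ
  set θ := H / (m : ℂ) with hθ
  set κ := Y / (m : ℂ) with hκ
  have hβ0 : β ≠ 0 := by
    intro h; rw [h, norm_zero] at hB; norm_num at hB
  have hinv : ∀ z : ℂ, 1 / 2 ≤ ‖z‖ → ∀ w : ℂ, ‖w / z‖ ≤ 2 * ‖w‖ := by
    intro z hz w
    rw [norm_div, div_le_iff₀ (by linarith)]
    nlinarith [norm_nonneg w]
  have hmC : (m : ℂ) ≠ 0 := by exact_mod_cast hm.ne'
  -- The integrals of `h - (θ / β) b` over the children; they sum to zero, so their sum over good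
  -- children can be moved to the bad ones.
  set U : ι → ℂ := fun s => Hc s - θ / β * Bc s with hU
  have hUsum : ∑ s ∈ G, U s = - ∑ s ∈ Gᶜ, U s := by
    rw [eq_neg_iff_add_eq_zero, Finset.sum_add_sum_compl]
    simp only [hU, Finset.sum_sub_distrib, ← Finset.mul_sum, hHsum, hBsum]
    have h1 : B = β * m := by rw [hβ]; field_simp
    have h2 : H = θ * m := by rw [hθ]; field_simp
    rw [h1, h2]
    field_simp
    ring
  set u : ι → ℂ := fun s => Hc s / mc s - θ / β * (Bc s / mc s) with hu
  set v : ι → ℂ := fun s => Yc s / mc s - κ / β * (Bc s / mc s) with hv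
  -- Subtracting `κ / β` times the zero-sum quantity `U` makes the second factor an oscillation too.
  -- Without this the term would be linear, not quadratic, in the oscillations.
  have hgood : ∀ s ∈ G, ((Hc s / mc s) / (Bc s / mc s) - θ / β) * Yc s =
      u s * (v s / (Bc s / mc s)) * mc s + κ / β * U s := by
    intro s hs
    have hs0 : (mc s : ℂ) ≠ 0 := by exact_mod_cast (hmG s hs).ne'
    have hb0 : Bc s ≠ 0 := by
      intro h
      have := hBG s hs
      rw [h, zero_div, norm_zero] at this
      norm_num at this
    simp only [hu, hv, hU]
    field_simp
    ring
  have hnorm : ‖∑ s ∈ G, ((Hc s / mc s) / (Bc s / mc s) - θ / β) * Yc s +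
        ∑ s ∈ Gᶜ, (E s - θ / β * Yc s)‖ ≤
      ∑ s ∈ G, 2 * (‖u s‖ * ‖v s‖) * mc s + ∑ s ∈ Gᶜ, 2 * ‖κ‖ * ‖U s‖ +
        ∑ s ∈ Gᶜ, (‖E s‖ + 2 * ‖θ‖ * ‖Yc s‖) := by
    rw [Finset.sum_congr rfl hgood, Finset.sum_add_distrib, ← Finset.mul_sum, hUsum]
    refine (norm_add_le _ _).trans (add_le_add ((norm_add_le _ _).trans (add_le_add ?_ ?_)) ?_)
    · refine norm_sum_le_of_le _ fun s hs => ?_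
      rw [norm_mul, norm_mul, Complex.norm_real, Real.norm_eq_abs, abs_of_nonneg (hmc s)]
      have := hinv _ (hBG s hs) (v s)
      have h2 : ‖u s‖ * ‖v s / (Bc s / mc s)‖ ≤ 2 * (‖u s‖ * ‖v s‖) := by
        nlinarith [norm_nonneg (u s)]
      exact mul_le_mul_of_nonneg_right h2 (hmc s)
    · rw [norm_mul, norm_neg, ← Finset.mul_sum]
      exact mul_le_mul (hinv _ hB _) (norm_sum_le _ _) (norm_nonneg _) (by positivity)
    · refine norm_sum_le_of_le _ fun s _ => (norm_sub_le _ _).trans ?_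
      gcongr
      rw [norm_mul]
      exact mul_le_mul_of_nonneg_right (hinv _ hB _) (norm_nonneg _)
  refine hnorm.trans ?_
  -- Replacing the child average of `b` by `β` costs the oscillation of `b`, with weight `|θ|` or
  -- `|κ|`; squared, this is a Carleson term.
  have hosc : ∀ (x : ℂ) (y : ℂ) s, ‖x - y / β * (Bc s / mc s)‖ ≤
      ‖x - y‖ + 2 * (‖y‖ * ‖Bc s / mc s - β‖) := by
    intro x y s
    have h1 : x - y / β * (Bc s / mc s) = (x - y) - y / β * (Bc s / mc s - β) := by
      field_simp
      ring
    rw [h1]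
    refine (norm_sub_le _ _).trans ?_
    gcongr
    rw [norm_mul]
    nlinarith [hinv _ hB y, norm_nonneg (Bc s / mc s - β)]
  have hG : ∑ s ∈ G, 2 * (‖u s‖ * ‖v s‖) * mc s ≤
      2 * ∑ s ∈ G, ‖Hc s / mc s - θ‖ ^ 2 * mc s + 2 * ∑ s ∈ G, ‖Yc s / mc s - κ‖ ^ 2 * mc s +
        8 * (‖θ‖ ^ 2 + ‖κ‖ ^ 2) * ∑ s ∈ G, ‖Bc s / mc s - β‖ ^ 2 * mc s := by
    simp only [Finset.mul_sum, ← Finset.sum_add_distrib]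
    refine Finset.sum_le_sum fun s _ => ?_
    have := mul_le_mul_of_nonneg_right
      (two_mul_norm_mul_norm_le (hosc (Hc s / mc s) θ s) (hosc (Yc s / mc s) κ s)) (hmc s)
    simp only [hu, hv]
    refine this.trans (le_of_eq ?_)
    ring
  have hbad1 : ∀ s ∈ Gᶜ, 2 * ‖κ‖ * ‖U s‖ ≤
      3 * ‖κ‖ ^ 2 * mc s + ηc s + 2 * ‖θ‖ ^ 2 * σc s := by
    intro s _
    have h1 : ‖U s‖ ≤ ‖Hc s‖ + 2 * ‖θ‖ * ‖Bc s‖ := by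
      refine (norm_sub_le _ _).trans ?_
      gcongr
      rw [norm_mul]
      exact mul_le_mul_of_nonneg_right (hinv _ hB _) (norm_nonneg _)
    have h2 := two_mul_mul_le_of_sq_le (a := ‖κ‖) (hmc s) (hη s) (hHc s)
    have h3 := two_mul_mul_le_of_sq_le (a := ‖κ‖) (x := ‖θ‖ * ‖Bc s‖) (hmc s)
      (q := ‖θ‖ ^ 2 * σc s) (mul_nonneg (sq_nonneg _) (hσ s)) (by
        rw [mul_pow]; nlinarith [mul_le_mul_of_nonneg_left (hBc s) (sq_nonneg ‖θ‖)])
    nlinarith [mul_le_mul_of_nonneg_left h1 (norm_nonneg κ)]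
  have hbad2 : ∀ s ∈ Gᶜ, ‖E s‖ + 2 * ‖θ‖ * ‖Yc s‖ ≤ A * ηc s + 2 * γc s + ‖θ‖ ^ 2 * σc s := by
    intro s hs
    have h1 := two_mul_mul_le_of_sq_le (a := 1) (mul_nonneg hA (hη s)) (hγ s) (hE s hs)
    have h2 := two_mul_mul_le_of_sq_le (a := ‖θ‖) (hσ s) (hγ s) (hYc s)
    have := hγ s
    have := mul_nonneg hA (hη s)
    linarith [norm_nonneg (E s)]
  have hb1 : ∑ s ∈ Gᶜ, 2 * ‖κ‖ * ‖U s‖ ≤ 3 * ‖κ‖ ^ 2 * ∑ s ∈ Gᶜ, mc s + ∑ s ∈ Gᶜ, ηc s +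
      2 * ‖θ‖ ^ 2 * ∑ s ∈ Gᶜ, σc s :=
    (Finset.sum_le_sum hbad1).trans_eq (by simp only [Finset.sum_add_distrib, ← Finset.mul_sum])
  have hb2 : ∑ s ∈ Gᶜ, (‖E s‖ + 2 * ‖θ‖ * ‖Yc s‖) ≤ A * ∑ s ∈ Gᶜ, ηc s + 2 * ∑ s ∈ Gᶜ, γc s +
      ‖θ‖ ^ 2 * ∑ s ∈ Gᶜ, σc s :=
    (Finset.sum_le_sum hbad2).trans_eq (by simp only [Finset.sum_add_distrib, ← Finset.mul_sum])
  have hcc : carlesonCoefficient G m mc σc B Bc = ∑ s ∈ Gᶜ, mc s + ∑ s ∈ Gᶜ, σc s +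
      ∑ s ∈ G, ‖Bc s / mc s - β‖ ^ 2 * mc s := by
    rw [carlesonCoefficient, Finset.sum_add_distrib]
  clear hbad1 hbad2
  rw [hcc]
  have p1 : 0 ≤ ∑ s ∈ Gᶜ, mc s := Finset.sum_nonneg fun s _ => hmc s
  have p2 : 0 ≤ ∑ s ∈ Gᶜ, σc s := Finset.sum_nonneg fun s _ => hσ s
  have p3 : 0 ≤ ∑ s ∈ Gᶜ, ηc s := Finset.sum_nonneg fun s _ => hη s
  have p4 : 0 ≤ ∑ s ∈ Gᶜ, γc s := Finset.sum_nonneg fun s _ => hγ s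
  have p5 : 0 ≤ ∑ s ∈ G, ‖Bc s / mc s - β‖ ^ 2 * mc s :=
    Finset.sum_nonneg fun s _ => mul_nonneg (sq_nonneg _) (hmc s)
  have p6 : 0 ≤ ∑ s ∈ G, ‖Hc s / mc s - θ‖ ^ 2 * mc s :=
    Finset.sum_nonneg fun s _ => mul_nonneg (sq_nonneg _) (hmc s)
  have p7 : 0 ≤ ∑ s ∈ G, ‖Yc s / mc s - κ‖ ^ 2 * mc s :=
    Finset.sum_nonneg fun s _ => mul_nonneg (sq_nonneg _) (hmc s)
  generalize ∑ s ∈ Gᶜ, mc s = q1 at *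
  generalize ∑ s ∈ Gᶜ, σc s = q2 at *
  generalize ∑ s ∈ Gᶜ, ηc s = q3 at *
  generalize ∑ s ∈ Gᶜ, γc s = q4 at *
  generalize ∑ s ∈ G, ‖Bc s / mc s - β‖ ^ 2 * mc s = q5 at *
  generalize ∑ s ∈ G, ‖Hc s / mc s - θ‖ ^ 2 * mc s = q6 at *
  generalize ∑ s ∈ G, ‖Yc s / mc s - κ‖ ^ 2 * mc s = q7 at *
  have hθ0 := sq_nonneg ‖θ‖
  have hκ0 := sq_nonneg ‖κ‖
  generalize ‖θ‖ ^ 2 = t at *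
  generalize ‖κ‖ ^ 2 = k at *
  have r1 : 0 ≤ A * (q6 + (q1 + q2 + q5) * t + (q7 + (q1 + q2 + q5) * k + q4)) := by positivity
  have r2 : 0 ≤ q1 * t := by positivity
  have r3 : 0 ≤ q2 * t := by positivity
  have r4 : 0 ≤ q1 * k := by positivity
  have r5 : 0 ≤ q2 * k := by positivity
  linarith

end NodeEstimates

/-! ### Summation over a tree by telescoping a potential. -/

section Tree

variable {β ι : Type*} {child : β → ι → β}

/-- `Reach child k Q R`: the node `R` is reached from `Q` in `k` steps. -/
def Reach (child : β → ι → β) : ℕ → β → β → Prop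
  | 0, Q, R => R = Q
  | k + 1, Q, R => ∃ s, Reach child k (child Q s) R

theorem Reach.trans_child {k : ℕ} : ∀ {Q R : β}, Reach child k Q R → ∀ s, Reach child (k + 1) Q
    (child R s) := by
  induction k with
  | zero =>
    rintro Q R rfl s
    exact ⟨s, rfl⟩
  | succ k ih =>
    rintro Q R ⟨t, ht⟩ s
    exact ⟨t, ih ht s⟩

/-- The sum of `x` over the nodes of the subtree `{p}` that are reached from `Q` in less than `N`
steps. -/
def treeSum [Fintype ι] (child : β → ι → β) (p : β → Prop) [DecidablePred p]
    (x : β → ℝ) : ℕ → β → ℝ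
  | 0, _ => 0
  | N + 1, Q => if p Q then x Q + ∑ s, treeSum child p x N (child Q s) else 0

variable [Fintype ι] {p : β → Prop} [DecidablePred p]

theorem treeSum_of_not {x : β → ℝ} {N : ℕ} {Q : β} (h : ¬ p Q) : treeSum child p x N Q = 0 := by
  cases N with
  | zero => rfl
  | succ N => rw [treeSum, if_neg h]

theorem treeSum_le_potential {x Φ : β → ℝ} (hΦ : ∀ Q, p Q → 0 ≤ Φ Q)
    (hstep : ∀ Q, p Q → x Q + ∑ s with p (child Q s), Φ (child Q s) ≤ Φ Q) (N : ℕ) :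
    ∀ Q, p Q → treeSum child p x N Q ≤ Φ Q := by
  induction N with
  | zero => exact fun Q hQ => hΦ Q hQ
  | succ N ih =>
    intro Q hQ
    rw [treeSum, if_pos hQ]
    refine le_trans ?_ (hstep Q hQ)
    gcongr
    rw [Finset.sum_filter]
    refine Finset.sum_le_sum fun s _ => ?_
    split_ifs with hs
    · exact ih _ hs
    · exact (treeSum_of_not hs).le

theorem treeSum_nonneg {x : β → ℝ} (hx : ∀ Q, p Q → 0 ≤ x Q) (N : ℕ) :
    ∀ Q, 0 ≤ treeSum child p x N Q := by
  induction N with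
  | zero => exact fun Q => le_rfl
  | succ N ih =>
    intro Q
    rw [treeSum]
    split_ifs with h
    · exact add_nonneg (hx Q h) (Finset.sum_nonneg fun s _ => ih _)
    · exact le_rfl

/-- `treeSum` stops at the first node outside `p`, so no node of `J` may lie beneath such a node.
The invariant `q` holds at everything below the root, and `hp` makes `p` pass from child to parent
there. -/
theorem sum_le_treeSum {x : β → ℝ} (hx : ∀ Q, p Q → 0 ≤ x Q)
    {q : β → Prop} (hq : ∀ Q s, q Q → q (child Q s)) (hp : ∀ Q s, q Q → p (child Q s) → p Q)
    (N : ℕ) : ∀ (Q : β) (J : Finset β), q Q → (∀ R ∈ J, p R ∧ ∃ k < N, Reach child k Q R) →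
      ∑ R ∈ J, x R ≤ treeSum child p x N Q := by
  classical
  induction N with
  | zero =>
    intro Q J hqQ hJ
    have : J = ∅ := Finset.eq_empty_of_forall_notMem fun R hR => by
      obtain ⟨-, k, hk, -⟩ := hJ R hR
      omega
    simp [this, treeSum]
  | succ N ih =>
    intro Q J hqQ hJ
    have hup : ∀ k, ∀ {Q R : β}, Reach child k Q R → q Q → p R → p Q := by
      intro k
      induction k with
      | zero => rintro Q R rfl _ h; exact h
      | succ k ihk => rintro Q R ⟨s, hs⟩ hQ h; exact hp Q s hQ (ihk hs (hq Q s hQ) h)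
    rcases J.eq_empty_or_nonempty with rfl | ⟨R₀, hR₀⟩
    · simpa using treeSum_nonneg hx (N + 1) Q
    have hQ : p Q := by
      obtain ⟨h, k, -, hk⟩ := hJ R₀ hR₀
      exact hup k hk hqQ h
    rw [treeSum, if_pos hQ]
    let J' : ι → Finset β := fun s => {R ∈ J | ∃ k < N, Reach child k (child Q s) R}
    have hsub : J ⊆ {Q} ∪ Finset.univ.biUnion J' := by
      intro R hR
      obtain ⟨-, k, hk, hreach⟩ := hJ R hR
      cases k with
      | zero => exact Finset.mem_union_left _ (Finset.mem_singleton.2 hreach)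
      | succ k =>
        obtain ⟨s, hs⟩ := hreach
        refine Finset.mem_union_right _ (Finset.mem_biUnion.2 ⟨s, Finset.mem_univ _, ?_⟩)
        exact Finset.mem_filter.2 ⟨hR, k, by omega, hs⟩
    have hJ' : ∀ s, ∑ R ∈ J' s, x R ≤ treeSum child p x N (child Q s) := fun s =>
      ih _ _ (hq Q s hqQ) fun R hR => ⟨(hJ R (Finset.mem_filter.1 hR).1).1, (Finset.mem_filter.1 hR).2⟩
    have hnn : ∀ R ∈ {Q} ∪ Finset.univ.biUnion J', 0 ≤ x R := by
      intro R hR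
      rcases Finset.mem_union.1 hR with h | h
      · rw [Finset.mem_singleton.1 h]; exact hx Q hQ
      · obtain ⟨s, -, hs⟩ := Finset.mem_biUnion.1 h
        exact hx R (hJ R (Finset.mem_filter.1 hs).1).1
    calc ∑ R ∈ J, x R ≤ ∑ R ∈ {Q} ∪ Finset.univ.biUnion J', x R :=
          Finset.sum_le_sum_of_subset_of_nonneg hsub fun R hR _ => hnn R hR
      _ ≤ ∑ R ∈ {Q}, x R + ∑ R ∈ Finset.univ.biUnion J', x R := by
          rw [← Finset.sum_union_inter]
          refine le_add_of_nonneg_right (Finset.sum_nonneg fun R hR => ?_)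
          exact hnn R (Finset.mem_union_left _ (Finset.mem_inter.1 hR).1)
      _ ≤ x Q + ∑ s, ∑ R ∈ J' s, x R := by
          rw [Finset.sum_singleton]
          gcongr
          -- A node may be reached through several children; as the terms are nonnegative, counting
          -- it repeatedly does no harm.
          have hcov : ∀ R ∈ Finset.univ.biUnion J', x R ≤ ∑ s, if R ∈ J' s then x R else 0 := by
            intro R hR
            obtain ⟨s, -, hs⟩ := Finset.mem_biUnion.1 hR
            have h0 := hnn R (Finset.mem_union_right _ hR)
            have := Finset.single_le_sum (f := fun s => if R ∈ J' s then x R else 0)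
              (fun i _ => by split_ifs <;> simp [h0]) (Finset.mem_univ s)
            simpa [hs] using this
          refine (Finset.sum_le_sum hcov).trans ?_
          rw [Finset.sum_comm]
          refine Finset.sum_le_sum fun s _ => le_of_eq ?_
          rw [← Finset.sum_filter]
          refine Finset.sum_congr ?_ fun _ _ => rfl
          ext R
          simp only [Finset.mem_filter]
          exact ⟨fun h => h.2, fun h => ⟨Finset.mem_biUnion.2 ⟨s, Finset.mem_univ _, h⟩, h⟩⟩
      _ ≤ _ := by gcongr with s; exact hJ' s

end Tree

/-! ### Unconditional convergence from bounded multipliers. -/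

section HilbertSpace

variable {H : Type*} [NormedAddCommGroup H] [InnerProductSpace ℂ H]

/-- Each new sign is chosen so that the cross term with the preceding partial sum is nonnegative. -/
theorem exists_sign_sum_sq_le (y : ℕ → H) (k : ℕ) : ∃ ε : ℕ → ℂ, (∀ i, ‖ε i‖ ≤ 1) ∧
    ∑ i ∈ Finset.range k, ‖y i‖ ^ 2 ≤ ‖∑ i ∈ Finset.range k, ε i • y i‖ ^ 2 := by
  induction k with
  | zero => exact ⟨0, by simp, by simp⟩
  | succ k ih =>
    obtain ⟨ε, hε, hk⟩ := ih
    set S := ∑ i ∈ Finset.range k, ε i • y i with hS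
    obtain ⟨δ, hδ, hδ'⟩ : ∃ δ : ℂ, ‖δ‖ = 1 ∧ 0 ≤ RCLike.re (inner ℂ S (δ • y k)) := by
      rcases le_total 0 (RCLike.re (inner ℂ S (y k))) with h | h
      · exact ⟨1, by simp, by simpa using h⟩
      · exact ⟨-1, by simp, by simpa using h⟩
    refine ⟨Function.update ε k δ, fun i => ?_, ?_⟩
    · rcases eq_or_ne i k with rfl | hi
      · simp [hδ]
      · simpa [hi] using hε i
    · have h1 : ∑ i ∈ Finset.range k, Function.update ε k δ i • y i = S := by
        refine Finset.sum_congr rfl fun i hi => ?_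
        rw [Function.update_of_ne (Finset.mem_range.1 hi).ne]
      rw [Finset.sum_range_succ, Finset.sum_range_succ, h1, Function.update_self,
        norm_add_sq (𝕜 := ℂ), norm_smul, hδ, one_mul]
      linarith

/-- A series in a Hilbert space whose finite sums with bounded multipliers are uniformly bounded
converges unconditionally. -/
theorem summable_of_bounded_multipliers [CompleteSpace H] {β : Type*} {x : β → H} {C : ℝ}
    (hC : ∀ (J : Finset β) (ε : β → ℂ), (∀ i, ‖ε i‖ ≤ 1) → ‖∑ i ∈ J, ε i • x i‖ ^ 2 ≤ C) :
    Summable x := by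
  classical
  rw [summable_iff_vanishing_norm]
  by_contra! hcon
  obtain ⟨δ, hδ, hJ⟩ := hcon
  choose t ht hδt using hJ
  -- If the Cauchy criterion fails, there are infinitely many disjoint blocks with sums of norm at
  -- least `δ`. Suitable signs, constant on blocks, make `k` of them contribute at least `k δ ^ 2`,
  -- which exceeds `C` for large `k`.
  let u : ℕ → Finset β := fun k => Nat.rec ∅ (fun _ s => s ∪ t s) k
  have hu : ∀ k, u (k + 1) = u k ∪ t (u k) := fun k => rfl
  have hmono : Monotone u := monotone_nat_of_le_succ fun k => by
    rw [hu]; exact Finset.subset_union_left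
  have hdisj : ∀ i j, i < j → Disjoint (t (u i)) (t (u j)) := by
    intro i j hij
    refine Finset.disjoint_of_subset_left ?_ (ht (u j)).symm
    exact (by rw [hu]; exact Finset.subset_union_right : t (u i) ⊆ u (i + 1)).trans (hmono hij)
  have hpair : Pairwise fun i j => Disjoint (t (u i)) (t (u j)) := by
    intro i j hij
    rcases lt_or_gt_of_ne hij with h | h
    · exact hdisj i j h
    · exact (hdisj j i h).symm
  have hbound : ∀ k : ℕ, k * δ ^ 2 ≤ C := by
    intro k
    obtain ⟨ε, hε, hsum⟩ := exists_sign_sum_sq_le (fun i => ∑ b ∈ t (u i), x b) k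
    let ε' : β → ℂ := fun b =>
      if h : ∃ i, b ∈ t (u i) then ε h.choose else 0
    have hε'eq : ∀ i, ∀ b ∈ t (u i), ε' b = ε i := by
      intro i b hb
      have h : ∃ i, b ∈ t (u i) := ⟨i, hb⟩
      have : h.choose = i := by
        by_contra hne
        exact Finset.disjoint_left.1 (hpair hne) h.choose_spec hb
      simp only [ε', dif_pos h, this]
    have hε' : ∀ b, ‖ε' b‖ ≤ 1 := by
      intro b
      by_cases h : ∃ i, b ∈ t (u i)
      · simp only [ε', dif_pos h]; exact hε _
      · simp [ε', dif_neg h]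
    have heq : ∑ b ∈ (Finset.range k).biUnion fun i => t (u i), ε' b • x b =
        ∑ i ∈ Finset.range k, ε i • ∑ b ∈ t (u i), x b := by
      rw [Finset.sum_biUnion fun i _ j _ hij => hpair hij]
      refine Finset.sum_congr rfl fun i _ => ?_
      rw [Finset.smul_sum]
      exact Finset.sum_congr rfl fun b hb => by rw [hε'eq i b hb]
    calc (k : ℝ) * δ ^ 2 = ∑ i ∈ Finset.range k, δ ^ 2 := by simp
      _ ≤ ∑ i ∈ Finset.range k, ‖∑ b ∈ t (u i), x b‖ ^ 2 := by
          gcongr with i; exact hδt (u i)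
      _ ≤ _ := hsum
      _ ≤ C := by rw [← heq]; exact hC _ _ hε'
  obtain ⟨k, hk⟩ := exists_nat_gt (C / δ ^ 2)
  rw [div_lt_iff₀ (by positivity)] at hk
  linarith [hbound k]

end HilbertSpace

/-! ### Geometry of the dyadic grid. -/

section Geometry

variable {n : ℕ}

theorem Cube.child_subset (Q : Cube n) (s : Fin n → Fin 2) : (Q.child s).toSet ⊆ Q.toSet :=
  (Cube.Dyadic.top.child s).subset_top

theorem Cube.iUnion_child (Q : Cube n) : ⋃ s, (Q.child s).toSet = Q.toSet := by
  refine Subset.antisymm (iUnion_subset Q.child_subset) fun x hx => ?_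
  refine mem_iUnion.2 ⟨fun i => if x i < Q.corner i + Q.side / 2 then 0 else 1, fun i => ?_⟩
  have h := hx i
  simp only [Cube.child]
  split_ifs with hi
  · simp only [Fin.val_zero, Nat.cast_zero]
    constructor <;> linarith
  · simp only [Fin.val_one, Nat.cast_one]
    constructor <;> linarith

theorem Cube.pairwise_disjoint_child (Q : Cube n) :
    Pairwise (Function.onFun Disjoint fun s => (Q.child s).toSet) := by
  intro s t hst
  refine disjoint_left.2 fun x hx hy => hst (funext fun i => ?_)
  have h1 := hx i
  have h2 := hy i
  have hq := Q.side_pos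
  simp only [Cube.child] at h1 h2
  obtain hs | hs : s i = 0 ∨ s i = 1 := by omega
  all_goals
    obtain ht | ht : t i = 0 ∨ t i = 1 := by omega
    all_goals first
      | exact hs.trans ht.symm
      | exfalso
        rw [hs] at h1
        rw [ht] at h2
        simp only [Fin.val_zero, Fin.val_one, Nat.cast_zero, Nat.cast_one] at h1 h2
        linarith

theorem Cube.measure_lt_top (μ : Measure (EuclideanSpace ℝ (Fin n))) [IsLocallyFiniteMeasure μ]
    (Q : Cube n) : μ Q.toSet < ∞ := by
  have hK : IsCompact ((EuclideanSpace.equiv (Fin n) ℝ).symm ''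
      Icc Q.corner fun i => Q.corner i + Q.side) :=
    isCompact_Icc.image (EuclideanSpace.equiv (Fin n) ℝ).symm.continuous
  refine (measure_mono fun x hx => ?_).trans_lt hK.measure_lt_top
  exact ⟨EuclideanSpace.equiv (Fin n) ℝ x, ⟨fun i => (hx i).1, fun i => (hx i).2.le⟩, by simp⟩

theorem Cube.Dyadic.eq_of_subset_of_le (hn : 0 < n) {Qs Q R : Cube n} (hQ : Qs.Dyadic Q)
    (hR : Qs.Dyadic R) (h : Q.toSet ⊆ R.toSet) (hle : R.side ≤ Q.side) : Q = R :=
  Cube.toSet_injective hn (h.antisymm (hR.subset_of_le hQ (h Q.corner_mem) Q.corner_mem hle))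

theorem Cube.Dyadic.side_le_half {Qs Q R : Cube n} (hQ : Qs.Dyadic Q) (hR : Qs.Dyadic R)
    (h : R.side < Q.side) : R.side ≤ Q.side / 2 := by
  obtain ⟨k, -, hk, -⟩ := hQ.exists_index
  obtain ⟨l, -, hl, -⟩ := hR.exists_index
  have hkl : k < l := by
    by_contra! hc
    have h5 : (2 : ℝ) ^ l ≤ 2 ^ k := pow_le_pow_right₀ (by norm_num) hc
    have := mul_lt_mul' h5 h R.side_pos.le (by positivity)
    linarith
  have h5 : (2 : ℝ) ^ (k + 1) ≤ 2 ^ l := pow_le_pow_right₀ (by norm_num) hkl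
  have h6 := mul_le_mul_of_nonneg_right h5 R.side_pos.le
  rw [← hl, hk, pow_succ] at h6
  have h7 : (0 : ℝ) < 2 ^ k := by positivity
  have h8 : (2 : ℝ) ^ k * (2 * R.side) ≤ 2 ^ k * Q.side := by linarith
  linarith [le_of_mul_le_mul_left h8 h7]

theorem Cube.Dyadic.exists_reach (hn : 0 < n) {Qs F : Cube n} (hF : Qs.Dyadic F) {Q : Cube n}
    (hQ : Qs.Dyadic Q) (h : Q.toSet ⊆ F.toSet) : ∃ k, Reach Cube.child k F Q := by
  induction hQ with
  | top => exact ⟨0, Cube.toSet_injective hn (h.antisymm hF.subset_top)⟩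
  | @child R hR s ih =>
    -- Side lengths of the grid drop by factors of two: a child strictly smaller than `F` has its
    -- parent still inside `F`, and one of equal side is `F`.
    rcases (Cube.side_le_of_subset hn h).lt_or_eq with hlt | heq
    · have hle : R.side ≤ F.side := by
        by_contra! hc
        have := hR.side_le_half hF hc
        simp only [Cube.child] at hlt
        linarith
      have hmem := (R.child s).corner_mem
      obtain ⟨k, hk⟩ := ih (hR.subset_of_le hF (R.child_subset s hmem) (h hmem) hle)
      exact ⟨k + 1, hk.trans_child s⟩
    · exact ⟨0, (hR.child s).eq_of_subset_of_le hn hF h heq.ge⟩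

end Geometry

/-! ### How stopping ancestors vary along the grid. -/

section Ancestors

variable {n : ℕ} {μ : Measure (EuclideanSpace ℝ (Fin n))}
  {T : Lp ℂ 2 μ →L[ℂ] Lp ℂ 2 μ} {A B : ℝ≥0} {Qs : Cube n} {b : Cube n → Lp ℂ 2 μ}

theorem isMinimalStopping_stoppingAncestor (hn : 0 < n) {Q : Cube n} (hQ : Qs.Dyadic Q) :
    IsMinimalStopping T A B Qs b Q (stoppingAncestor T A B Qs b Q) :=
  (stoppingAncestor_eq_iff T A B Qs b hn hQ).1 rfl

/-- The ancestor of a child is either that of the parent, or the child itself. -/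
theorem stoppingAncestor_child (hn : 0 < n) {Q : Cube n} (hQ : Qs.Dyadic Q)
    (s : Fin n → Fin 2) :
    stoppingAncestor T A B Qs b (Q.child s) = stoppingAncestor T A B Qs b Q ∨
      stoppingAncestor T A B Qs b (Q.child s) = Q.child s := by
  obtain ⟨hF1, hF2, hF3⟩ := isMinimalStopping_stoppingAncestor (T := T) (A := A) (B := B) (b := b)
    hn hQ
  obtain ⟨hS1, hS2, hS3⟩ := isMinimalStopping_stoppingAncestor (T := T) (A := A) (B := B) (b := b)
    hn (hQ.child s)
  set F := stoppingAncestor T A B Qs b Q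
  set S := stoppingAncestor T A B Qs b (Q.child s)
  have hSd := dyadic_of_mem_stoppingCubes T A B Qs b hS1
  have hmem := (Q.child s).corner_mem
  by_cases hle : Q.side ≤ S.side
  · left
    have hQS := hQ.subset_of_le hSd (Q.child_subset s hmem) (hS2 hmem) hle
    exact Cube.toSet_injective hn ((hS3 F hF1 ((Q.child_subset s).trans hF2)).antisymm
      (hF3 S hS1 hQS))
  · right
    exact ((hQ.child s).eq_of_subset_of_le hn hSd hS2 (hQ.side_le_half hSd (not_le.1 hle))).symm

theorem stoppingAncestor_of_child (hn : 0 < n) {Q F : Cube n} (hQ : Qs.Dyadic Q)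
    (hF : F ∈ stoppingCubes T A B Qs b) (hQF : Q.toSet ⊆ F.toSet) {s : Fin n → Fin 2}
    (h : stoppingAncestor T A B Qs b (Q.child s) = F) : stoppingAncestor T A B Qs b Q = F := by
  obtain ⟨-, -, hF3⟩ := (stoppingAncestor_eq_iff T A B Qs b hn (hQ.child s)).1 h
  refine (stoppingAncestor_eq_iff T A B Qs b hn hQ).2 ⟨hF, hQF, fun R hR hQR => ?_⟩
  exact hF3 R hR ((Q.child_subset s).trans hQR)

/-- A cube below `F` that satisfies a stopping condition lies in a proper stopping cube. -/
theorem not_stopCondition_of_stoppingAncestor (hn : 0 < n) {Q F : Cube n} (hQ : Qs.Dyadic Q)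
    (hself : ¬ StopCondition T A B b F F) (h : stoppingAncestor T A B Qs b Q = F) :
    ¬ StopCondition T A B b F Q := by
  classical
  obtain ⟨hF1, hF2, hF3⟩ := (stoppingAncestor_eq_iff T A B Qs b hn hQ).1 h
  intro hcond
  let P : ℕ → Prop := fun k => ∃ R, Qs.Dyadic R ∧ Q.toSet ⊆ R.toSet ∧ R.toSet ⊆ F.toSet ∧
    StopCondition T A B b F R ∧ Qs.side = 2 ^ k * R.side
  have hP : ∃ k, P k := by
    obtain ⟨k, -, hk, -⟩ := hQ.exists_index
    exact ⟨k, Q, hQ, subset_rfl, hF2, hcond, hk⟩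
  -- The least generation `k` gives the largest stopping cube between `Q` and `F`, hence a stopping
  -- child of `F`. Minimality of `F` above `Q` then forces it to be `F`.
  obtain ⟨R, hR, hQR, hRF, hRstop, hRk⟩ := Nat.find_spec hP
  have hRF' : R ∈ stoppingChildren T A B Qs b F := by
    refine ⟨hR, hRF, hRstop, fun R' hR' hR'F hR'stop hRR' => ?_⟩
    obtain ⟨l, -, hl, -⟩ := hR'.exists_index
    have hle := Nat.find_min' hP ⟨R', hR', hQR.trans hRR', hR'F, hR'stop, hl⟩
    refine (hR.eq_of_subset_of_le hn hR' hRR' ?_).symm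
    by_contra! hc
    have h5 : (2 : ℝ) ^ Nat.find hP ≤ 2 ^ l := pow_le_pow_right₀ (by norm_num) hle
    have := mul_lt_mul' h5 hc R.side_pos.le (by positivity)
    linarith
  have hRmem : R ∈ stoppingCubes T A B Qs b := by
    obtain ⟨j, hj⟩ := mem_iUnion.1 hF1
    exact mem_iUnion.2 ⟨j + 1, F, hj, hRF'⟩
  have : R = F := Cube.toSet_injective hn (hRF.antisymm (hF3 R hRmem hQR))
  exact hself (this ▸ hRstop)

end Ancestors

/-! ### Cauchy–Schwarz on sets, for elements of `L²`. -/

section L2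

variable {α : Type*} [MeasurableSpace α] {ν : Measure α}

theorem norm_integral_mul_sq_le {f g : α → ℂ} (hf : MemLp f 2 ν) (hg : MemLp g 2 ν) :
    ‖∫ x, f x * g x ∂ν‖ ^ 2 ≤ (∫ x, ‖f x‖ ^ 2 ∂ν) * ∫ x, ‖g x‖ ^ 2 ∂ν := by
  have h1 : ‖∫ x, f x * g x ∂ν‖ ≤ ∫ x, ‖f x‖ * ‖g x‖ ∂ν := by
    refine (norm_integral_le_integral_norm _).trans (le_of_eq ?_)
    simp only [norm_mul]
  have h2 := integral_mul_norm_le_Lp_mul_Lq (μ := ν) (f := f) (g := g)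
    (Real.HolderConjugate.two_two) (by simpa using hf) (by simpa using hg)
  have h0 : ∀ f : α → ℂ, 0 ≤ ∫ x, ‖f x‖ ^ (2 : ℝ) ∂ν := fun f =>
    integral_nonneg fun x => by positivity
  have h3 := h1.trans h2
  rw [← Real.mul_rpow (h0 f) (h0 g), ← Real.sqrt_eq_rpow] at h3
  have h4 := pow_le_pow_left₀ (norm_nonneg _) h3 2
  rw [Real.sq_sqrt (mul_nonneg (h0 f) (h0 g))] at h4
  simpa only [Real.rpow_two] using h4

theorem norm_sq_eq_integral (f : Lp ℂ 2 ν) : ‖f‖ ^ 2 = ∫ x, ‖f x‖ ^ 2 ∂ν := by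
  have h1 := inner_self_eq_norm_sq (𝕜 := ℂ) f
  have h2 : inner ℂ f f = ((∫ x, ‖f x‖ ^ 2 ∂ν : ℝ) : ℂ) := by
    rw [L2.inner_def, ← integral_complex_ofReal]
    refine integral_congr_ae (Filter.Eventually.of_forall fun x => ?_)
    simp only [inner_self_eq_norm_sq_to_K]
    simp
  rw [← h1, h2]
  simp

theorem integrable_norm_sq (f : Lp ℂ 2 ν) : Integrable (fun x => ‖f x‖ ^ 2) ν :=
  (Lp.memLp f).integrable_norm_pow two_ne_zero

theorem setIntegral_norm_sq_le (f : Lp ℂ 2 ν) (s : Set α) :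
    ∫ x in s, ‖f x‖ ^ 2 ∂ν ≤ ‖f‖ ^ 2 := by
  rw [norm_sq_eq_integral]
  exact setIntegral_le_integral (integrable_norm_sq f)
    (Filter.Eventually.of_forall fun x => by positivity)

theorem lintegral_enorm_sq_eq (f : Lp ℂ 2 ν) (s : Set α) :
    ∫⁻ x in s, ‖f x‖ₑ ^ 2 ∂ν = ENNReal.ofReal (∫ x in s, ‖f x‖ ^ 2 ∂ν) := by
  rw [ofReal_integral_eq_lintegral_ofReal (integrable_norm_sq f).integrableOn
    (Filter.Eventually.of_forall fun x => by positivity)]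
  refine lintegral_congr fun x => ?_
  rw [ENNReal.ofReal_pow (norm_nonneg _), ofReal_norm]

theorem norm_setIntegral_sq_le (f : Lp ℂ 2 ν) {s : Set α} (hs : ν s ≠ ∞) :
    ‖∫ x in s, f x ∂ν‖ ^ 2 ≤ ν.real s * ∫ x in s, ‖f x‖ ^ 2 ∂ν := by
  have : IsFiniteMeasure (ν.restrict s) := ⟨by simpa using hs.lt_top⟩
  have := norm_integral_mul_sq_le (ν := ν.restrict s) (f := f) (g := fun _ => 1)
    ((Lp.memLp f).restrict s) (memLp_const 1)
  simpa [mul_comm] using this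

theorem norm_setIntegral_mul_conj_sq_le (f g : Lp ℂ 2 ν) (s : Set α) :
    ‖∫ x in s, f x * starRingEnd ℂ (g x) ∂ν‖ ^ 2 ≤
      (∫ x in s, ‖f x‖ ^ 2 ∂ν) * ∫ x in s, ‖g x‖ ^ 2 ∂ν := by
  simpa using norm_integral_mul_sq_le ((Lp.memLp f).restrict s) ((Lp.memLp g).restrict s).star

theorem integrableOn_of_lp_two (f : Lp ℂ 2 ν) {s : Set α} (hs : ν s ≠ ∞) :
    IntegrableOn f s ν := by
  have : IsFiniteMeasure (ν.restrict s) := ⟨by simpa using hs.lt_top⟩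
  exact ((Lp.memLp f).restrict s).integrable (by norm_num)

theorem integrable_mul_conj (f g : Lp ℂ 2 ν) :
    Integrable (fun x => f x * starRingEnd ℂ (g x)) ν :=
  (Lp.memLp f).integrable_mul (Lp.memLp g).star

end L2

/-! ### What the stopping conditions say about the test functions. -/

section TestFunctions

variable {n : ℕ} {μ : Measure (EuclideanSpace ℝ (Fin n))} [IsLocallyFiniteMeasure μ]
  {T : Lp ℂ 2 μ →L[ℂ] Lp ℂ 2 μ} {A B : ℝ≥0} {Qs : Cube n} {b : Cube n → Lp ℂ 2 μ}

/-- Cauchy–Schwarz applied to the normalisation: `μ(F)² ≤ μ(F) · A μ(F)`. -/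
theorem IsTestFamily.one_le (hb : IsTestFamily T A B Qs b) {F : Cube n} (hF : Qs.Dyadic F)
    (hm : 0 < μ.real F.toSet) : (1 : ℝ) ≤ A := by
  have h1 := norm_setIntegral_sq_le (b F) (F.measure_lt_top μ).ne
  rw [hb.normalised F hF, Complex.norm_real, Real.norm_eq_abs, sq_abs] at h1
  have h2 := (setIntegral_norm_sq_le (b F) F.toSet).trans (hb.norm_sq_le F hF)
  nlinarith [mul_le_mul_of_nonneg_left h2 hm.le, mul_pos hm hm]

/-- On a null cube the strict inequalities fail. Otherwise the average is 1, and `A ≥ 1` places the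
thresholds `16 A²` and `16 A B` above the constants `A` and `B` of the global bounds. Without this,
a cube with ancestor `F` could meet a stopping condition for `b_F` merely because `F` does. -/
theorem IsTestFamily.not_stopCondition_self (hb : IsTestFamily T A B Qs b) {F : Cube n}
    (hF : Qs.Dyadic F) : ¬ StopCondition T A B b F F := by
  have hfin := (F.measure_lt_top μ).ne
  rcases (measureReal_nonneg (μ := μ) (s := F.toSet)).eq_or_lt with h0 | hm
  · have hμ : μ F.toSet = 0 := (measureReal_eq_zero_iff hfin).1 h0.symm
    rintro (h | h | h)
    · rw [← h0, mul_zero] at h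
      exact absurd h (not_lt.2 (norm_nonneg _))
    · rw [setLIntegral_measure_zero _ _ hμ] at h
      exact not_lt_zero h
    · rw [← h0, setIntegral_measure_zero _ hμ, mul_zero] at h
      exact lt_irrefl _ h
  · have hA := hb.one_le hF hm
    rintro (h | h | h)
    · rw [hb.normalised F hF, Complex.norm_real, Real.norm_eq_abs, abs_of_pos hm] at h
      linarith
    · refine absurd h (not_lt.2 ?_)
      calc ∫⁻ x in F.toSet, maximalFunction μ (b F) x ^ 2 ∂μ
          ≤ ∫⁻ x, maximalFunction μ (b F) x ^ 2 ∂μ := setLIntegral_le_lintegral _ _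
        _ ≤ maximalNorm μ ^ 2 * ∫⁻ x, ‖b F x‖ₑ ^ 2 ∂μ := lintegral_maximal_sq_le_maximalNorm _
        _ ≤ maximalNorm μ ^ 2 * (16 * (A : ℝ≥0∞) ^ 2 * μ F.toSet) := by
            gcongr
            rw [← setLIntegral_univ, lintegral_enorm_sq_eq, setIntegral_univ,
              ← norm_sq_eq_integral]
            refine (ENNReal.ofReal_le_ofReal (q := 16 * A ^ 2 * μ.real F.toSet)
              ((hb.norm_sq_le F hF).trans ?_)).trans (le_of_eq ?_)
            · gcongr
              nlinarith
            · rw [ENNReal.ofReal_mul (by positivity), ofReal_measureReal hfin,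
                ENNReal.ofReal_mul (by norm_num), ENNReal.ofReal_pow A.coe_nonneg]
              simp
        _ = _ := by ring
    · have h1 := hb.testing F hF
      have h2 : (B : ℝ) * μ.real F.toSet ≤ 16 * (A : ℝ) * B * μ.real F.toSet := by
        have : 0 ≤ (B : ℝ) * μ.real F.toSet := by positivity
        nlinarith
      linarith

/-- On a cube that does not satisfy the second stopping condition the test function is controlled
in mean square. -/
theorem IsTestFamily.integral_norm_sq_le (hb : IsTestFamily T A B Qs b) {F Q : Cube n}
    (hF : Qs.Dyadic F) (hQ : ¬ StopCondition T A B b F Q) {N : ℕ} (hN : maximalNorm μ ≤ N) :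
    ∫ x in Q.toSet, ‖b F x‖ ^ 2 ∂μ ≤ 16 * A ^ 2 * N ^ 2 * μ.real Q.toSet := by
  have hfinF := (F.measure_lt_top μ).ne
  have hfin := (Q.measure_lt_top μ).ne
  simp only [StopCondition, not_or, not_lt] at hQ
  -- The differentiation theorem is used for an integrable function; `b F` is one because it lives
  -- on a set of finite measure.
  have hint : Integrable (b F) μ :=
    (integrableOn_of_lp_two (b F) hfinF).integrable_of_ae_notMem_eq_zero (hb.support F hF)
  have hpt := enorm_le_maximalFunction (Lp.stronglyMeasurable (b F)).measurable.aemeasurable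
    (hasFiniteIntegral_iff_enorm.1 hint.2).ne
  have h1 : ENNReal.ofReal (∫ x in Q.toSet, ‖b F x‖ ^ 2 ∂μ) ≤
      ENNReal.ofReal (16 * A ^ 2 * N ^ 2 * μ.real Q.toSet) := by
    rw [← lintegral_enorm_sq_eq]
    calc ∫⁻ x in Q.toSet, ‖b F x‖ₑ ^ 2 ∂μ
        ≤ ∫⁻ x in Q.toSet, maximalFunction μ (b F) x ^ 2 ∂μ := by
          refine lintegral_mono_ae ?_
          filter_upwards [ae_restrict_of_ae hpt] with x hx
          gcongr
      _ ≤ 16 * (A : ℝ≥0∞) ^ 2 * maximalNorm μ ^ 2 * μ Q.toSet := hQ.2.1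
      _ ≤ 16 * (A : ℝ≥0∞) ^ 2 * N ^ 2 * μ Q.toSet := by gcongr
      _ = _ := by
          rw [ENNReal.ofReal_mul (by positivity), ofReal_measureReal hfin,
            ENNReal.ofReal_mul (by positivity), ENNReal.ofReal_mul (by norm_num),
            ENNReal.ofReal_pow A.coe_nonneg]
          simp
  exact (ENNReal.ofReal_le_ofReal_iff (by positivity)).1 h1

end TestFunctions

/-! ### The twisted differences paired with a dual function, and their sum. -/

section TwistedDifference

variable {n : ℕ} {μ : Measure (EuclideanSpace ℝ (Fin n))}

theorem inner_indicatorLp_left (Q : Cube n) (f g : Lp ℂ 2 μ) :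
    inner ℂ (indicatorLp Q g) f = ∫ x in Q.toSet, f x * starRingEnd ℂ (g x) ∂μ := by
  rw [L2.inner_def, ← integral_indicator Q.measurableSet_toSet]
  refine integral_congr_ae ?_
  filter_upwards [((Lp.memLp g).indicator Q.measurableSet_toSet).coeFn_toLp] with x hx
  rw [indicatorLp, hx]
  by_cases h : x ∈ Q.toSet <;> simp [h, mul_comm]

theorem inner_indicatorLp_right (Q : Cube n) (f g : Lp ℂ 2 μ) :
    inner ℂ g (indicatorLp Q f) = inner ℂ (indicatorLp Q g) f := by
  rw [inner_indicatorLp_left, L2.inner_def, ← integral_indicator Q.measurableSet_toSet]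
  refine integral_congr_ae ?_
  filter_upwards [((Lp.memLp f).indicator Q.measurableSet_toSet).coeFn_toLp] with x hx
  rw [indicatorLp, hx]
  by_cases h : x ∈ Q.toSet <;> simp [h]

theorem inner_twistedDifference (T : Lp ℂ 2 μ →L[ℂ] Lp ℂ 2 μ) (A B : ℝ≥0) (Qs : Cube n)
    (b : Cube n → Lp ℂ 2 μ) (Q : Cube n) (g h : Lp ℂ 2 μ) :
    inner ℂ g (twistedDifference T A B Qs b Q h) = ∑ s : Fin n → Fin 2,
      (((⨍ x in (Q.child s).toSet, h x ∂μ) /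
          (⨍ x in (Q.child s).toSet, b (stoppingAncestor T A B Qs b (Q.child s)) x ∂μ)) *
        ∫ x in (Q.child s).toSet, b (stoppingAncestor T A B Qs b (Q.child s)) x *
          starRingEnd ℂ (g x) ∂μ -
      ((⨍ x in Q.toSet, h x ∂μ) / (⨍ x in Q.toSet, b (stoppingAncestor T A B Qs b Q) x ∂μ)) *
        ∫ x in (Q.child s).toSet, b (stoppingAncestor T A B Qs b Q) x *
          starRingEnd ℂ (g x) ∂μ) := by
  rw [twistedDifference, inner_sum]
  refine Finset.sum_congr rfl fun s _ => ?_
  rw [inner_indicatorLp_right, inner_sub_right, inner_smul_right, inner_smul_right,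
    inner_indicatorLp_left, inner_indicatorLp_left]

theorem setAverage_eq_div (f : EuclideanSpace ℝ (Fin n) → ℂ)
    (s : Set (EuclideanSpace ℝ (Fin n))) :
    ⨍ x in s, f x ∂μ = (∫ x in s, f x ∂μ) / (μ.real s : ℂ) := by
  rw [setAverage_eq, Complex.real_smul, div_eq_inv_mul]
  push_cast
  rfl

theorem sum_setIntegral_child {E : Type*} [NormedAddCommGroup E] [NormedSpace ℝ E] (Q : Cube n)
    {f : EuclideanSpace ℝ (Fin n) → E} (hf : IntegrableOn f Q.toSet μ) :
    ∑ s : Fin n → Fin 2, ∫ x in (Q.child s).toSet, f x ∂μ = ∫ x in Q.toSet, f x ∂μ := by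
  rw [← Q.iUnion_child, integral_iUnion_fintype (fun s => (Q.child s).measurableSet_toSet)
    Q.pairwise_disjoint_child fun s => hf.mono_set (Q.child_subset s)]

variable [IsLocallyFiniteMeasure μ]

theorem sum_measureReal_child (Q : Cube n) :
    ∑ s : Fin n → Fin 2, μ.real (Q.child s).toSet = μ.real Q.toSet := by
  have := sum_setIntegral_child (μ := μ) Q (f := fun _ => (1 : ℝ))
    (integrableOn_const (Q.measure_lt_top μ).ne)
  simpa using this

/-- The potential of a cube, for the square function of `f` with energy density `|g|²`. -/
def cubePotential (μ : Measure (EuclideanSpace ℝ (Fin n))) (K c M : ℝ) (β : Lp ℂ 2 μ)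
    (f : EuclideanSpace ℝ (Fin n) → ℂ) (g : Lp ℂ 2 μ) (Q : Cube n) : ℝ :=
  squarePotential c M (μ.real Q.toSet)
    (carlesonPotential K (μ.real Q.toSet) (∫ x in Q.toSet, ‖β x‖ ^ 2 ∂μ) ‖∫ x in Q.toSet, β x ∂μ‖)
    ‖∫ x in Q.toSet, f x ∂μ‖ (∫ x in Q.toSet, ‖g x‖ ^ 2 ∂μ)

section Node

variable (T : Lp ℂ 2 μ →L[ℂ] Lp ℂ 2 μ) (A B : ℝ≥0) (Qs : Cube n) (b : Cube n → Lp ℂ 2 μ)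

/-- The cubes of positive measure with stopping ancestor `F`. -/
def Active (F Q : Cube n) : Prop :=
  Qs.Dyadic Q ∧ stoppingAncestor T A B Qs b Q = F ∧ 0 < μ.real Q.toSet

variable {T A B Qs b}

theorem IsTestFamily.active_bounds (hn : 0 < n) (hb : IsTestFamily T A B Qs b) {N : ℕ}
    (hN : maximalNorm μ ≤ N) {F Q : Cube n} (hF : Qs.Dyadic F) (hQ : Active T A B Qs b F Q) :
    1 / 2 ≤ ‖(∫ x in Q.toSet, b F x ∂μ) / (μ.real Q.toSet : ℂ)‖ ∧
      ∫ x in Q.toSet, ‖b F x‖ ^ 2 ∂μ ≤ 16 * A ^ 2 * N ^ 2 * μ.real Q.toSet := by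
  have hcond := not_stopCondition_of_stoppingAncestor hn hQ.1 (hb.not_stopCondition_self hF) hQ.2.1
  refine ⟨?_, hb.integral_norm_sq_le hF hcond hN⟩
  simp only [StopCondition, not_or, not_lt] at hcond
  rw [norm_div, Complex.norm_real, Real.norm_eq_abs, abs_of_pos hQ.2.2, le_div_iff₀ hQ.2.2]
  exact hcond.1

theorem carlesonPotential_cube_nonneg {K : ℝ} (hK : 0 ≤ K) (β : Lp ℂ 2 μ) {Q : Cube n}
    (hm : 0 < μ.real Q.toSet) :
    0 ≤ carlesonPotential K (μ.real Q.toSet) (∫ x in Q.toSet, ‖β x‖ ^ 2 ∂μ)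
      ‖∫ x in Q.toSet, β x ∂μ‖ :=
  carlesonPotential_nonneg hm hK (integral_nonneg fun _ => by positivity)
    (norm_setIntegral_sq_le β (Q.measure_lt_top μ).ne)

/-- The single-cube inequalities applied to `b_F`, `h` and `b_F ḡ`. The constant `c` is the one
required by `carleson_step` with `L = 3 K + 1`, the bound for the Carleson potential per unit of
mass. -/
theorem IsTestFamily.pairing_step (hn : 0 < n) (hb : IsTestFamily T A B Qs b) {N : ℕ}
    (hN : maximalNorm μ ≤ N) {F : Cube n} (hF : Qs.Dyadic F) (g h : Lp ℂ 2 μ) {K c M : ℝ}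
    (hK : K = 16 * A ^ 2 * N ^ 2) (hc : c = 2 * (1 + (3 * K + 1)) ^ 2) (hM : 2 * c ^ 2 + 2 ≤ M)
    [DecidablePred (Active T A B Qs b F)] {Q : Cube n} (hQ : Active T A B Qs b F Q) :
    ‖inner ℂ g (twistedDifference T A B Qs b Q h)‖ +
      ∑ s with Active T A B Qs b F (Q.child s), (A + 8 : ℝ) *
        (cubePotential μ K c M (b F) h h (Q.child s) +
          cubePotential μ K c M (b F) (fun x => b F x * starRingEnd ℂ (g x)) g (Q.child s)) ≤
      (A + 8 : ℝ) * (cubePotential μ K c M (b F) h h Q +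
          cubePotential μ K c M (b F) (fun x => b F x * starRingEnd ℂ (g x)) g Q) := by
  classical
  have hK0 : 0 ≤ K := by rw [hK]; positivity
  have hm := hQ.2.2
  have hfin := (Q.measure_lt_top μ).ne
  set G : Finset (Fin n → Fin 2) := {s | Active T A B Qs b F (Q.child s)} with hG
  have hGmem : ∀ s ∈ G, Active T A B Qs b F (Q.child s) := fun s hs =>
    (Finset.mem_filter.1 hs).2
  have hGc : ∀ s ∈ Gᶜ, μ.real (Q.child s).toSet = 0 ∨
      stoppingAncestor T A B Qs b (Q.child s) = Q.child s := by
    intro s hs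
    have h1 : ¬ Active T A B Qs b F (Q.child s) := by simpa [hG] using hs
    by_contra! hcon
    refine h1 ⟨hQ.1.child s, ?_, lt_of_le_of_ne measureReal_nonneg hcon.1.symm⟩
    exact ((stoppingAncestor_child hn hQ.1 s).resolve_right hcon.2).trans hQ.2.1
  set m := μ.real Q.toSet with hmdef
  set σ := ∫ x in Q.toSet, ‖b F x‖ ^ 2 ∂μ with hσdef
  set β := ∫ x in Q.toSet, b F x ∂μ with hβdef
  set H := ∫ x in Q.toSet, h x ∂μ with hHdef
  set Y := ∫ x in Q.toSet, b F x * starRingEnd ℂ (g x) ∂μ with hYdef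
  set mc : (Fin n → Fin 2) → ℝ := fun s => μ.real (Q.child s).toSet with hmc
  set σc : (Fin n → Fin 2) → ℝ := fun s => ∫ x in (Q.child s).toSet, ‖b F x‖ ^ 2 ∂μ with hσc
  set ηc : (Fin n → Fin 2) → ℝ := fun s => ∫ x in (Q.child s).toSet, ‖h x‖ ^ 2 ∂μ with hηc
  set γc : (Fin n → Fin 2) → ℝ := fun s => ∫ x in (Q.child s).toSet, ‖g x‖ ^ 2 ∂μ with hγc
  set βc : (Fin n → Fin 2) → ℂ := fun s => ∫ x in (Q.child s).toSet, b F x ∂μ with hβc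
  set Hc : (Fin n → Fin 2) → ℂ := fun s => ∫ x in (Q.child s).toSet, h x ∂μ with hHc
  set Yc : (Fin n → Fin 2) → ℂ := fun s =>
    ∫ x in (Q.child s).toSet, b F x * starRingEnd ℂ (g x) ∂μ with hYc
  set E : (Fin n → Fin 2) → ℂ := fun s => (⨍ x in (Q.child s).toSet, h x ∂μ) /
          (⨍ x in (Q.child s).toSet, b (stoppingAncestor T A B Qs b (Q.child s)) x ∂μ) *
        ∫ x in (Q.child s).toSet, b (stoppingAncestor T A B Qs b (Q.child s)) x *
          starRingEnd ℂ (g x) ∂μ with hE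
  have hcfin : ∀ s, μ (Q.child s).toSet ≠ ∞ := fun s => ((Q.child s).measure_lt_top μ).ne
  have mc0 : ∀ s, 0 ≤ mc s := fun s => measureReal_nonneg
  have σc0 : ∀ s, 0 ≤ σc s := fun s => integral_nonneg fun _ => by positivity
  have ηc0 : ∀ s, 0 ≤ ηc s := fun s => integral_nonneg fun _ => by positivity
  have γc0 : ∀ s, 0 ≤ γc s := fun s => integral_nonneg fun _ => by positivity
  have mcG : ∀ s ∈ G, 0 < mc s := fun s hs => (hGmem s hs).2.2
  have msum : ∑ s, mc s = m := sum_measureReal_child Q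
  have σsum : ∑ s, σc s = σ := sum_setIntegral_child Q (integrable_norm_sq _).integrableOn
  have ηsum : ∑ s, ηc s = _ := sum_setIntegral_child Q (integrable_norm_sq h).integrableOn
  have γsum : ∑ s, γc s = _ := sum_setIntegral_child Q (integrable_norm_sq g).integrableOn
  have βsum : ∑ s, βc s = β := sum_setIntegral_child Q (integrableOn_of_lp_two _ hfin)
  have Hsum : ∑ s, Hc s = H := sum_setIntegral_child Q (integrableOn_of_lp_two _ hfin)
  have Ysum : ∑ s, Yc s = Y := sum_setIntegral_child Q (integrable_mul_conj _ _).integrableOn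
  have hβσ : ∀ s, ‖βc s‖ ^ 2 ≤ mc s * σc s := fun s => norm_setIntegral_sq_le _ (hcfin s)
  have hHη : ∀ s, ‖Hc s‖ ^ 2 ≤ mc s * ηc s := fun s => norm_setIntegral_sq_le _ (hcfin s)
  have hYγ : ∀ s, ‖Yc s‖ ^ 2 ≤ σc s * γc s := fun s => norm_setIntegral_mul_conj_sq_le _ _ _
  obtain ⟨hβ2, hσK⟩ := hb.active_bounds hn hN hF hQ
  rw [← hK] at hσK
  have hβG : ∀ s ∈ G, 1 / 2 ≤ ‖βc s / mc s‖ := fun s hs =>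
    (hb.active_bounds hn hN hF (hGmem s hs)).1
  -- A bad child of positive measure carries its own test function, of average 1 and energy at most
  -- `A` times the mass; no information on `b_F` is needed there.
  have hEc : ∀ s ∈ Gᶜ, ‖E s‖ ^ 2 ≤ (A * ηc s) * γc s := by
    intro s hs
    rcases eq_or_ne (mc s) 0 with h0 | h0
    · have : μ (Q.child s).toSet = 0 := (measureReal_eq_zero_iff (hcfin s)).1 h0
      have hE0 : E s = 0 := by
        simp only [hE]
        rw [setIntegral_measure_zero _ this, mul_zero]
      rw [hE0]
      simpa using mul_nonneg (mul_nonneg A.coe_nonneg (ηc0 s)) (γc0 s)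
    · have hanc := (hGc s hs).resolve_left h0
      have hmpos : 0 < mc s := lt_of_le_of_ne (mc0 s) h0.symm
      have hd := hQ.1.child s
      have hE1 : E s = Hc s / mc s *
          ∫ x in (Q.child s).toSet, b (Q.child s) x * starRingEnd ℂ (g x) ∂μ := by
        simp only [hE]
        rw [hanc, setAverage_eq_div, setAverage_eq_div, hb.normalised _ hd,
          div_self (by exact_mod_cast h0), div_one]
      have h1 := norm_setIntegral_mul_conj_sq_le (b (Q.child s)) g (Q.child s).toSet
      have h2 := (setIntegral_norm_sq_le (b (Q.child s)) (Q.child s).toSet).trans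
        (hb.norm_sq_le _ hd)
      rw [hE1, norm_mul, norm_div, Complex.norm_real, Real.norm_eq_abs, abs_of_pos hmpos, mul_pow,
        div_pow]
      calc ‖Hc s‖ ^ 2 / mc s ^ 2 * _ ≤ (mc s * ηc s) / mc s ^ 2 * (A * mc s * γc s) := by
            gcongr
            · exact hHη s
            · exact h1.trans (mul_le_mul_of_nonneg_right h2 (γc0 s))
        _ = (A * ηc s) * γc s := by field_simp
  have hinner : inner ℂ g (twistedDifference T A B Qs b Q h) =
      ∑ s ∈ G, ((Hc s / mc s) / (βc s / mc s) - (H / m) / (β / m)) * Yc s +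
        ∑ s ∈ Gᶜ, (E s - (H / m) / (β / m) * Yc s) := by
    rw [inner_twistedDifference, ← Finset.sum_add_sum_compl G]
    congr 1
    · refine Finset.sum_congr rfl fun s hs => ?_
      rw [(hGmem s hs).2.1, hQ.2.1, sub_mul]
      simp only [setAverage_eq_div]
      rfl
    · refine Finset.sum_congr rfl fun s hs => ?_
      rw [hQ.2.1, setAverage_eq_div _ Q.toSet, setAverage_eq_div _ Q.toSet]
  have hpair := norm_twisted_pairing_le (Y := Y) A.coe_nonneg hm mc0 mcG βsum Hsum σc0 ηc0 γc0
    hβσ hHη hYγ hEc hβ2 hβG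
  rw [← hinner] at hpair
  have hβm : ‖β / m‖ ^ 2 ≤ K := by
    rw [norm_div, Complex.norm_real, Real.norm_eq_abs, abs_of_pos hm, div_pow,
      div_le_iff₀ (by positivity)]
    have h1 : ‖β‖ ^ 2 ≤ m * σ := norm_setIntegral_sq_le _ hfin
    nlinarith [mul_le_mul_of_nonneg_left hσK hm.le]
  have hΛ := carlesonPotential_step (G := G) hm mc0 mcG msum βsum σc0 σsum hβσ hβm
  have hΛL := carlesonPotential_le (W := ‖β‖) hm hσK
  have hΛc : ∀ s ∈ G, 0 ≤ carlesonPotential K (mc s) (σc s) ‖βc s‖ := fun s hs =>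
    carlesonPotential_cube_nonneg hK0 (b F) (mcG s hs)
  have hα := carlesonCoefficient_nonneg (G := G) (m := m) (Z := β) (Zc := βc) mc0 σc0
  have hosc : 0 ≤ ∑ s ∈ G, ‖βc s / mc s - β / m‖ ^ 2 * mc s :=
    Finset.sum_nonneg fun s _ => mul_nonneg (sq_nonneg _) (mc0 s)
  have hmα : ∑ s ∈ Gᶜ, mc s ≤ carlesonCoefficient G m mc σc β βc := by
    rw [carlesonCoefficient, Finset.sum_add_distrib]
    linarith [Finset.sum_nonneg fun s (_ : s ∈ Gᶜ) => σc0 s]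
  have hσα : ∑ s ∈ Gᶜ, σc s ≤ carlesonCoefficient G m mc σc β βc := by
    rw [carlesonCoefficient, Finset.sum_add_distrib]
    linarith [Finset.sum_nonneg fun s (_ : s ∈ Gᶜ) => mc0 s]
  -- On bad children, `∫ h` is measured against the mass and `∫ b_F ḡ` against the energy of `b_F`.
  -- The Carleson coefficient contains both, so one potential serves both steps.
  have hH := squarePotential_step hm mc0 mcG msum Hsum hα hΛc hΛ hΛL (by linarith) mc0 ηc0 ηsum
    (fun s _ => hHη s) hmα hc hM
  have hY := squarePotential_step hm mc0 mcG msum Ysum hα hΛc hΛ hΛL (by linarith) σc0 γc0 γsum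
    (fun s _ => hYγ s) hσα hc hM
  rw [← Finset.mul_sum, Finset.sum_add_distrib]
  have hA8 : (0 : ℝ) ≤ A + 8 := by positivity
  have hfinal := mul_le_mul_of_nonneg_left (add_le_add hH hY) hA8
  refine le_trans ?_ hfinal
  simp only [cubePotential]
  linarith [hpair]

end Node

section Sum

variable {T : Lp ℂ 2 μ →L[ℂ] Lp ℂ 2 μ} {A B : ℝ≥0} {Qs : Cube n} {b : Cube n → Lp ℂ 2 μ}

/-- The constant in the estimate for twisted martingale differences. -/
def pairingConstant (A K c : ℝ) : ℝ :=
  (A + 8) * (2 * c ^ 2 + 2 + (2 * c + 1) * (K + 1))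

/-- The potential telescopes down the tree below `F`, and its value at `F` is at most `(A + 8) M
(‖h‖² + ‖g‖²)`. -/
theorem IsTestFamily.sum_pairing_le (hn : 0 < n) (hb : IsTestFamily T A B Qs b) {N : ℕ}
    (hN : maximalNorm μ ≤ N) {F : Cube n} (hF : F ∈ stoppingCubes T A B Qs b) {K c : ℝ}
    (hK : K = 16 * A ^ 2 * N ^ 2) (hc : c = 2 * (1 + (3 * K + 1)) ^ 2) (g h : Lp ℂ 2 μ)
    (J : Finset {Q : Cube n // Qs.Dyadic Q ∧ stoppingAncestor T A B Qs b Q = F}) :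
    ∑ Q ∈ J, ‖inner ℂ g (twistedDifference T A B Qs b Q h)‖ ≤
      pairingConstant A K c * (‖h‖ ^ 2 + ‖g‖ ^ 2) := by
  classical
  have hFd := dyadic_of_mem_stoppingCubes T A B Qs b hF
  have hK0 : 0 ≤ K := by rw [hK]; positivity
  have hc0 : 0 ≤ c := by rw [hc]; positivity
  have hA8 : (0 : ℝ) ≤ A + 8 := by positivity
  -- Large enough for the telescoping step and for nonnegativity with both factors, 1 and `K`.
  set M := 2 * c ^ 2 + 2 + (2 * c + 1) * (K + 1) with hM
  have hcK : 0 ≤ (2 * c + 1) * K := by positivity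
  have hM1 : 2 * c ^ 2 + 2 ≤ M := by rw [hM]; linarith
  have hMK : (2 * c + 1) * K ≤ M := by rw [hM]; nlinarith
  have hM1' : (2 * c + 1) * 1 ≤ M := by rw [hM]; nlinarith
  have hM0 : 0 ≤ M := by rw [hM]; positivity
  set x : Cube n → ℝ := fun Q => ‖inner ℂ g (twistedDifference T A B Qs b Q h)‖ with hx
  set Φ : Cube n → ℝ := fun Q => (A + 8 : ℝ) * (cubePotential μ K c M (b F) h h Q +
    cubePotential μ K c M (b F) (fun x => b F x * starRingEnd ℂ (g x)) g Q) with hΦ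
  have hΦ0 : ∀ Q, Active T A B Qs b F Q → 0 ≤ Φ Q := by
    intro Q hQ
    have hΛ := carlesonPotential_cube_nonneg hK0 (b F) hQ.2.2
    have hσK := (hb.active_bounds hn hN hFd hQ).2
    rw [← hK] at hσK
    refine mul_nonneg hA8 (add_nonneg ?_ ?_)
    · refine squarePotential_nonneg hQ.2.2 hΛ hc0 (integral_nonneg fun _ => by positivity) ?_ hM1'
      rw [one_mul]
      exact norm_setIntegral_sq_le h (Q.measure_lt_top μ).ne
    · refine squarePotential_nonneg hQ.2.2 hΛ hc0 (integral_nonneg fun _ => by positivity) ?_ hMK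
      refine (norm_setIntegral_mul_conj_sq_le _ _ _).trans ?_
      rw [← mul_assoc]
      exact mul_le_mul_of_nonneg_right hσK (integral_nonneg fun _ => by positivity)
  -- The potential divides by the mass, so null cubes are discarded first; their pairings vanish.
  have hnull : ∀ Q, μ.real Q.toSet = 0 → x Q = 0 := by
    intro Q hQ
    have hQ0 := (measureReal_eq_zero_iff (Q.measure_lt_top μ).ne).1 hQ
    simp only [hx]
    rw [inner_twistedDifference, Finset.sum_eq_zero, norm_zero]
    intro s _
    have := measure_mono_null (Q.child_subset s) hQ0
    rw [setIntegral_measure_zero _ this, setIntegral_measure_zero _ this, mul_zero, mul_zero,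
      sub_zero]
  have hJ : ∑ Q ∈ J, x Q = ∑ Q ∈ (J.map (Function.Embedding.subtype _)).filter
      (Active T A B Qs b F), x Q := by
    rw [Finset.sum_filter_of_ne, Finset.sum_map]
    · rfl
    · intro Q hQ hne
      obtain ⟨⟨R, hR⟩, -, rfl⟩ := Finset.mem_map.1 hQ
      exact ⟨hR.1, hR.2, lt_of_le_of_ne measureReal_nonneg fun h0 => hne (hnull _ h0.symm)⟩
  rw [hJ]
  set J' := (J.map (Function.Embedding.subtype _)).filter (Active T A B Qs b F)
  have hreach : ∀ Q ∈ J', ∃ k, Reach Cube.child k F Q := by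
    intro Q hQ
    have hact := (Finset.mem_filter.1 hQ).2
    refine hFd.exists_reach hn hact.1 ?_
    exact ((stoppingAncestor_eq_iff T A B Qs b hn hact.1).1 hact.2.1).2.1
  choose! k hk using hreach
  have hsum := sum_le_treeSum (child := Cube.child) (p := Active T A B Qs b F) (x := x)
    (q := fun Q => Qs.Dyadic Q ∧ Q.toSet ⊆ F.toSet) (fun Q _ => norm_nonneg _)
    (fun Q s hQ => ⟨hQ.1.child s, (Q.child_subset s).trans hQ.2⟩)
    (fun Q s hQ hs => ⟨hQ.1, stoppingAncestor_of_child hn hQ.1 hF hQ.2 hs.2.1,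
      hs.2.2.trans_le (measureReal_mono (Q.child_subset s) (Q.measure_lt_top μ).ne)⟩)
    (J'.sup k + 1) F J' ⟨hFd, subset_rfl⟩ fun Q hQ =>
      ⟨(Finset.mem_filter.1 hQ).2, k Q, Nat.lt_succ_of_le (Finset.le_sup hQ), hk Q hQ⟩
  refine hsum.trans ?_
  have hrhs : 0 ≤ pairingConstant A K c * (‖h‖ ^ 2 + ‖g‖ ^ 2) :=
    mul_nonneg (mul_nonneg hA8 hM0) (by positivity)
  by_cases hFact : Active T A B Qs b F F
  · refine (treeSum_le_potential hΦ0 (fun Q hQ => hb.pairing_step hn hN hFd g h hK hc hM1 hQ) _ F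
      hFact).trans ?_
    have hΛ := carlesonPotential_cube_nonneg hK0 (b F) hFact.2.2
    rw [pairingConstant, mul_assoc, mul_add]
    refine mul_le_mul_of_nonneg_left (add_le_add ?_ ?_) hA8
    · exact (squarePotential_le hFact.2.2 hΛ hc0).trans
        (mul_le_mul_of_nonneg_left (setIntegral_norm_sq_le _ _) hM0)
    · exact (squarePotential_le hFact.2.2 hΛ hc0).trans
        (mul_le_mul_of_nonneg_left (setIntegral_norm_sq_le _ _) hM0)
  · rw [treeSum_of_not hFact]
    exact hrhs

/-- The dual element is the sum itself times `(2 C₀)⁻¹`; with this scale the quadratic term in `g`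
becomes half of `‖S‖²` and is absorbed on the left. -/
theorem norm_sum_smul_sq_le_of_pairing {E β : Type*} [NormedAddCommGroup E]
    [InnerProductSpace ℂ E] {y : β → E} {J : Finset β} {C₀ D : ℝ} (hC : 0 < C₀)
    (hy : ∀ g : E, ∑ i ∈ J, ‖inner ℂ g (y i)‖ ≤ C₀ * (D + ‖g‖ ^ 2)) {a : β → ℂ}
    (ha : ∀ i ∈ J, ‖a i‖ ≤ 1) : ‖∑ i ∈ J, a i • y i‖ ^ 2 ≤ 4 * C₀ ^ 2 * D := by
  set S := ∑ i ∈ J, a i • y i with hS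
  have h1 : ‖S‖ ^ 2 ≤ ∑ i ∈ J, ‖inner ℂ S (y i)‖ := by
    have h2 : ‖inner ℂ S S‖ = ‖S‖ ^ 2 := by
      rw [inner_self_eq_norm_sq_to_K]
      simp
    rw [← h2]
    nth_rewrite 2 [hS]
    rw [inner_sum]
    refine norm_sum_le_of_le _ fun i hi => ?_
    rw [inner_smul_right, norm_mul]
    exact mul_le_of_le_one_left (norm_nonneg _) (ha i hi)
  have h3 := hy (((2 * C₀)⁻¹ : ℂ) • S)
  have hn : ‖((2 * C₀)⁻¹ : ℂ)‖ = (2 * C₀)⁻¹ := by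
    rw [norm_inv, norm_mul, Complex.norm_real, Real.norm_eq_abs, abs_of_pos hC]
    simp
  simp only [inner_smul_left, norm_mul, RCLike.norm_conj, norm_smul, hn, mul_pow,
    ← Finset.mul_sum] at h3
  rw [inv_mul_le_iff₀ (by positivity)] at h3
  have h4 : 2 * C₀ * (C₀ * (D + (2 * C₀)⁻¹ ^ 2 * ‖S‖ ^ 2)) = 2 * C₀ ^ 2 * D + ‖S‖ ^ 2 / 2 := by
    field_simp
  linarith

end Sum

end TwistedDifference

end TwistedMartingale

end

theorem proposition2p4 (n : ℕ) (hn : 0 < n) (A : ℝ≥0) :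
    ∃ C : ℝ≥0,
      ∀ (μ : Measure (EuclideanSpace ℝ (Fin n))) [IsLocallyFiniteMeasure μ]
        (T : Lp ℂ 2 μ →L[ℂ] Lp ℂ 2 μ) (B : ℝ≥0)
        (Qs : TwistedMartingale.Cube n) (b : TwistedMartingale.Cube n → Lp ℂ 2 μ),
        TwistedMartingale.IsTestFamily T A B Qs b →
        ∀ F ∈ TwistedMartingale.stoppingCubes T A B Qs b,
        ∀ (h : Lp ℂ 2 μ) (ε : TwistedMartingale.Cube n → ℂ),
          (∀ Q, Qs.Dyadic Q → ‖ε Q‖ ≤ 1) →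
          ∃ S : Lp ℂ 2 μ,
            HasSum
              (fun Q : {Q : TwistedMartingale.Cube n //
                  Qs.Dyadic Q ∧ TwistedMartingale.stoppingAncestor T A B Qs b Q = F} =>
                ε Q • TwistedMartingale.twistedDifference T A B Qs b Q h) S ∧
            ‖S‖ ^ 2 ≤ C * ‖h‖ ^ 2 := by
  obtain ⟨N, hN⟩ := TwistedMartingale.exists_maximalNorm_le n
  set K : ℝ := 16 * A ^ 2 * N ^ 2 with hK
  set c : ℝ := 2 * (1 + (3 * K + 1)) ^ 2 with hc
  have hK0 : 0 ≤ K := by positivity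
  have hC : 0 < TwistedMartingale.pairingConstant A K c := by
    rw [TwistedMartingale.pairingConstant]; positivity
  refine ⟨⟨4 * TwistedMartingale.pairingConstant A K c ^ 2, by positivity⟩, ?_⟩
  intro μ _ T B Qs b hb F hF h ε hε
  -- The further multipliers `a` give unconditional convergence of the series that already contains
  -- `ε`; `a = 1` gives the norm bound, which passes to the limit.
  have hbound : ∀ (J : Finset {Q : TwistedMartingale.Cube n //
      Qs.Dyadic Q ∧ TwistedMartingale.stoppingAncestor T A B Qs b Q = F})
      (a : {Q : TwistedMartingale.Cube n //
      Qs.Dyadic Q ∧ TwistedMartingale.stoppingAncestor T A B Qs b Q = F} → ℂ), (∀ i, ‖a i‖ ≤ 1) →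
      ‖∑ Q ∈ J, a Q • ε Q • TwistedMartingale.twistedDifference T A B Qs b Q h‖ ^ 2 ≤
        4 * TwistedMartingale.pairingConstant A K c ^ 2 * ‖h‖ ^ 2 := by
    intro J a ha
    simp only [smul_smul]
    refine TwistedMartingale.norm_sum_smul_sq_le_of_pairing hC
      (fun g => hb.sum_pairing_le hn (hN μ) hF hK hc g h J) fun Q _ => ?_
    rw [norm_mul]
    exact mul_le_one₀ (ha Q) (norm_nonneg _) (hε Q Q.2.1)
  obtain ⟨S, hS⟩ := TwistedMartingale.summable_of_bounded_multipliers hbound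
  refine ⟨S, hS, le_of_tendsto ((Filter.Tendsto.norm hS).pow 2) ?_⟩
  exact Filter.Eventually.of_forall fun J => by
    have hJ := hbound J (fun _ => 1) (by simp)
    simp only [one_smul] at hJ
    exact hJ
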